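/- \textbf{Theorem (Representation by theta series).} Let $M$ be a finite abelian group and $\mathcal Q\colon M\to\mathbb Q/\mathbb Z$ a non-degenerate quadratic form, i.e. $\mathcal Q(-x)=\mathcal Q(x)$, the map $\mathcal B(x,y)=\mathcal Q(x+y)-\mathcal Q(x)-\mathcal Q(y)$ is $\mathbb Z$-bilinear, and for each $x\neq 0$ there is a $y$ with $\mathcal B(x,y)\ne 0$. Let $V$ be a rational vector space of finite even dimension $2r$, let $L\subset V$ be a complete lattice and $Q$ a positive definite quadratic form on $V$ which takes integral values on $L$. Put $B(x,y)=Q(x+y)-Q(x)-Q(y)$ and $L^\sharp=\{y\in V: B(L,y)\subset\mathbb Z\}$, and let $\pi\colon L^\sharp/L\to M$ be an isomorphism of groups with $\mathcal Q(\pi(x+L))=Q(x)+\mathbb Z$ for all $x\in L^\sharp$ (so $(L,Q)$ is a lift of $(M,\mathcal Q)$). Let $p\colon V\to\mathbb C$ be a homogeneous spherical polynomial of degree $\nu\geq 0$ with respect to $Q$, i.e. with respect to a basis $b_j$ of $V$ with Gram matrix $G=(B(b_j,b_k))_{j,k}$, $p(\sum_j b_j\xi_j)$ is a complex homogeneous polynomial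 of degree $\nu$ in the $\xi_j$ which is annihilated by $\sum_{j,k}(G^{-1})_{jk}\,\partial^2/\partial\xi_j\partial\xi_k$. For $t=s+\mathbb Z\in\mathbb Q/\mathbb Z$ write $e(t)=e^{2\pi i s}$, and let $\Gamma=\mathrm{SL}(2,\mathbb Z)$, $T=\begin{pmatrix}1&1\\0&1\end{pmatrix}$, $S=\begin{pmatrix}0&-1\\1&0\end{pmatrix}$. Then there is exactly one right representation $\omega$ of $\Gamma$ on the space $\mathbb C^M$ of functions $f\colon M\to\mathbb C$ (the Weil representation associated to $(M,\mathcal Q)$) such that $$f|\omega(T)(x)=e(\mathcal Q(x))f(x),\qquad f|\omega(S)(x)=\gamma(1)^{-1}\sum_{y\in M}e(-\mathcal B(x,y))f(y),\qquad \gamma(1)=\sum_{x\in M}e(\mathcal Q(x)).$$ For $f\in\mathbb C^M$ and $\tau$ in the complex upper half plane the series $$\theta_f(\tau)=\sum_{x\in L^\sharp}f(\pi(x+L))\,p(x)\,e^{2\pi i Q(x)\tau}$$ converges absolutely, the map $f\mapsto\theta_f$ is linear, and $$\theta_f|_{r+\nu}A=\theta_{f|\omega(A)}\qquad\text{for all }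 f\in\mathbb C^M,\ A\in\Gamma,$$ where $(F|_kA)(\tau)=(c\tau+d)^{-k}F\!\left(\frac{a\tau+b}{c\tau+d}\right)$ for $A=\begin{pmatrix}a&b\\c&d\end{pmatrix}$. That is, $f\mapsto\theta_f$ is a homomorphism of (right) $\Gamma$-modules. -/

import Mathlib

open scoped MatrixGroups UpperHalfPlane ModularForm

noncomputable section

namespace WeilTheta

/-- The group `ℚ/ℤ`. -/
abbrev QModZ : Type := AddCircle (1 : ℚ)

theorem periodic_exp :
    Function.Periodic (fun r : ℚ => Complex.exp (2 * Real.pi * Complex.I * (r : ℂ))) 1 := by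
  intro r
  have h : 2 * (Real.pi : ℂ) * Complex.I * (((r + 1 : ℚ)) : ℂ)
      = 2 * Real.pi * Complex.I * (r : ℂ) + 2 * Real.pi * Complex.I := by
    push_cast
    ring
  simp only [h]
  exact Complex.exp_periodic _

/-- The character `e : ℚ/ℤ → ℂ`, `e(r + ℤ) = exp(2πir)`. -/
def e (t : QModZ) : ℂ := periodic_exp.lift t

theorem e_coe (r : ℚ) : e (r : QModZ) = Complex.exp (2 * Real.pi * Complex.I * (r : ℂ)) :=
  rfl

section QuadraticModule

variable {M : Type*} [AddCommGroup M]

/-- `(M, 𝒬)` is a quadratic module: `𝒬` is even, the map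
`ℬ(x, y) = 𝒬(x + y) - 𝒬(x) - 𝒬(y)` is `ℤ`-bilinear (it is symmetric, so additivity in the first
variable is enough), and `ℬ` is non-degenerate. -/
structure IsQuadraticModule (𝒬 : M → QModZ) : Prop where
  even : ∀ x, 𝒬 (-x) = 𝒬 x
  polar_add_left : ∀ x y z, QuadraticMap.polar 𝒬 (x + y) z
    = QuadraticMap.polar 𝒬 x z + QuadraticMap.polar 𝒬 y z
  nondegenerate : ∀ x, x ≠ 0 → ∃ y, QuadraticMap.polar 𝒬 x y ≠ 0

variable [Fintype M]

/-- The Gauss sum `γ(1) = ∑_{x ∈ M} e(𝒬(x))`. -/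
def gaussSum (𝒬 : M → QModZ) : ℂ := ∑ x, e (𝒬 x)

/-- `ω` is a (proper) Weil representation of `(M, 𝒬)`: a right representation of `SL(2, ℤ)` on
`ℂ^M`, i.e. a left representation of the opposite group, `ω (op A) f` being `f|ω(A)`, in which
the generators `T` and `S` act by the formulas
`f|ω(T)(x) = e(𝒬(x)) f(x)` and `f|ω(S)(x) = γ(1)⁻¹ ∑_y e(-ℬ(x, y)) f(y)`. -/
structure IsWeilRepresentation (𝒬 : M → QModZ)
    (ω : SL(2, ℤ)ᵐᵒᵖ →* Module.End ℂ (M → ℂ)) : Prop where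
  apply_T : ∀ f x, ω (MulOpposite.op ModularGroup.T) f x = e (𝒬 x) * f x
  apply_S : ∀ f x, ω (MulOpposite.op ModularGroup.S) f x
    = (gaussSum 𝒬)⁻¹ * ∑ y, e (-QuadraticMap.polar 𝒬 x y) * f y

end QuadraticModule

section Lattice

variable {V : Type*} [AddCommGroup V] [Module ℚ V]

/-- The dual lattice `L^♯ = {y | B(L, y) ⊆ ℤ}`, where `B(x, y) = Q(x + y) - Q(x) - Q(y)`. -/
def dualLattice (L : Submodule ℤ V) (Q : QuadraticForm ℚ V) : Submodule ℤ V :=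
  LinearMap.BilinForm.dualSubmodule Q.polarBilin L

theorem mem_dualLattice {L : Submodule ℤ V} {Q : QuadraticForm ℚ V} {y : V} :
    y ∈ dualLattice L Q ↔ ∀ x ∈ L, ∃ n : ℤ, QuadraticMap.polar Q x y = n := by
  unfold dualLattice
  rw [LinearMap.BilinForm.mem_dualSubmodule]
  refine forall₂_congr fun x _ => ?_
  rw [Submodule.mem_one]
  simp only [QuadraticMap.polarBilin_apply_apply, algebraMap_int_eq, eq_intCast]
  rw [QuadraticMap.polar_comm]
  exact exists_congr fun n => eq_comm

/-- The discriminant group `L^♯ / L`. -/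
abbrev DiscriminantGroup (L : Submodule ℤ V) (Q : QuadraticForm ℚ V) : Type _ :=
  dualLattice L Q ⧸ L.submoduleOf (dualLattice L Q)

/-- A lift of `(M, 𝒬)`: a complete lattice `L` in `V` and a positive definite quadratic form `Q`
on `V`, integral on `L`, together with an isomorphism of quadratic modules
`π : (L^♯ / L, x + L ↦ Q(x) + ℤ) ≃ (M, 𝒬)`. -/
structure Lift {M : Type*} [AddCommGroup M] (𝒬 : M → QModZ)
    (L : Submodule ℤ V) (Q : QuadraticForm ℚ V) where
  isLattice : Submodule.IsLattice ℚ L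
  posDef : Q.PosDef
  integral : ∀ x ∈ L, ∃ n : ℤ, Q x = n
  π : DiscriminantGroup L Q ≃+ M
  map_π : ∀ x : dualLattice L Q,
    𝒬 (π (Submodule.Quotient.mk x)) = ((Q (x : V) : ℚ) : QModZ)

/-- `p : V → ℂ` is a homogeneous spherical polynomial of degree `ν` with respect to `Q`: in the
coordinates of a basis `b` of `V` it is given by a complex homogeneous polynomial `P` of degree `ν`
with `∇ G⁻¹ ∇' P = 0`, where `G` is the Gram matrix of `B` (the condition does not depend on
the basis). -/
def IsSpherical (Q : QuadraticForm ℚ V) (ν : ℕ) (p : V → ℂ) : Prop :=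
  ∃ (b : Module.Basis (Fin (Module.finrank ℚ V)) ℚ V)
    (P : MvPolynomial (Fin (Module.finrank ℚ V)) ℂ),
    P.IsHomogeneous ν ∧
    (∀ ξ : Fin (Module.finrank ℚ V) → ℚ,
      p (∑ j, ξ j • b j) = MvPolynomial.eval (fun j => (ξ j : ℂ)) P) ∧
    ∑ j, ∑ k,
      MvPolynomial.C
          ((((Matrix.of fun i l => QuadraticMap.polar Q (b i) (b l))⁻¹ j k : ℚ)) : ℂ) *
        MvPolynomial.pderiv j (MvPolynomial.pderiv k P) = 0

variable {M : Type*} [AddCommGroup M] {𝒬 : M → QModZ} {L : Submodule ℤ V}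
  {Q : QuadraticForm ℚ V}

/-- The term `(π^* f)(x) p(x) q^{Q(x)}` of the theta series, `q^{Q(x)} = exp(2πi Q(x) τ)`. -/
def thetaTerm (ℓ : Lift 𝒬 L Q) (p : V → ℂ) (f : M → ℂ) (τ : ℍ) (x : dualLattice L Q) : ℂ :=
  f (ℓ.π (Submodule.Quotient.mk x)) * p x *
    Complex.exp (2 * Real.pi * Complex.I * ((Q (x : V) : ℚ) : ℂ) * (τ : ℂ))

/-- The theta series `θ_f = ∑_{x ∈ L^♯} (π^* f)(x) p(x) q^{Q(x)}`. -/
def theta (ℓ : Lift 𝒬 L Q) (p : V → ℂ) (f : M → ℂ) (τ : ℍ) : ℂ :=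
  ∑' x : dualLattice L Q, thetaTerm ℓ p f τ x

end Lattice

end WeilTheta

end

/-!
# Theta series and the Weil representation

The theta series `θ_f` is handled through the two generators `T` and `S` of `SL(2, ℤ)`. For `T`
the formula is read off termwise (`theta_slash_T`). For `S` it is Poisson summation:

* `V` is embedded isometrically in a Euclidean space, where `L` and `L^♯` are spanned by dual bases
  (`exists_euclidean_embedding`, `exists_lattice_bases`). Poisson summation, obtained from Fourier
  series on the torus (`tsum_add_intCast_eq_tsum_fourier`), gives the inversion formula
  `exists_gaussian_poisson` for the Gaussian, with a free shift `z` of the lattice.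
* Applying the differential operator `P(∂_z)` to this identity yields `P` on the Fourier side and
  the heat flow `exp((a/2)Δ) P` on the other side (`tsum_heat_polyGauss`). A spherical polynomial is
  harmonic, so it is fixed by the heat flow, and `tsum_harmonic_gaussian` follows. Summing over the
  cosets of `L` in `L^♯` gives `θ_f|S = c θ_{f^}` with the finite Fourier transform `f^`, where the
  constant `c` does not depend on the polynomial (`theta_slash_S`).

Neither the covolume of `L` nor the value of the Gauss sum is computed. The relation `TSTST = S`,
applied to the theta series of `L` with constant polynomial, gives `c² γ(1) θ = c θ` for the theta
series `θ` of `L^♯`, which is nonzero because it is positive on the imaginary axis; hence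
`c = γ(1)⁻¹` (`mul_gaussSum_eq_one`).

The existence of the Weil representation is deduced from the theta series too, without a
presentation of `SL(2, ℤ)`. The map `f ↦ θ_f` has a kernel, but the family of the theta series of
all Heisenberg translates of `f` determines `f` (`eq_zero_of_thetaOne_heis`). The Heisenberg operators
are parametrized by pairs of vectors of `L^♯`, on which `SL(2, ℤ)` acts, and the operators of the
generators respect this action (`heis_T`, `heis_S`). Therefore the functions `v ↦ θ_{ρ(v) f}` form a
space stable under the slash action, which is transported to `ℂ^M` (`exists_isWeilRepresentation`).
Uniqueness and the transformation formula for a general polynomial then only have to be checked on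
the generators.
-/

noncomputable section

namespace WeilTheta

/-! ### Poisson summation on `ℝ^ι` -/

section Poisson

open MeasureTheory

theorem summable_lattice_decay {ι E : Type*} [Fintype ι] [NormedAddCommGroup E] [NormedSpace ℝ E]
    (β : Module.Basis ι ℝ E) :
    Summable fun m : ι → ℤ => ((1 + ‖∑ i, (m i : ℝ) • β i‖) ^ (Fintype.card ι + 1))⁻¹ := by
  classical
  have : FiniteDimensional ℝ E := Module.Finite.of_basis β
  let Λ := Submodule.span ℤ (Set.range β)
  let c : Module.Basis ι ℤ Λ := β.restrictScalars ℤ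
  have hfr : Module.finrank ℤ Λ = Fintype.card ι := Module.finrank_eq_card_basis c
  have h1 := ZLattice.summable_norm_pow_inv Λ (Fintype.card ι + 1) (by omega)
  have h2 := (c.equivFun.symm.toEquiv.summable_iff).mpr h1
  have hc : ∀ m : ι → ℤ, ‖c.equivFun.symm m‖ = ‖∑ i, (m i : ℝ) • β i‖ := by
    intro m
    rw [← Submodule.norm_coe, Module.Basis.equivFun_symm_apply, Submodule.coe_sum]
    refine congrArg _ (Finset.sum_congr rfl fun i _ => ?_)
    rw [Submodule.coe_smul, Int.cast_smul_eq_zsmul]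
    exact congrArg _ (Module.Basis.restrictScalars_apply ℤ β i)
  refine Summable.of_norm_bounded_eventually h2 ?_
  refine (Set.finite_singleton (0 : ι → ℤ)).subset ?_
  intro m hm
  by_contra hne
  apply hm
  have hpos : 0 < ‖c.equivFun.symm m‖ := by
    rw [norm_pos_iff]
    exact fun h => hne (c.equivFun.symm.map_eq_zero_iff.mp h)
  change ‖((1 + ‖∑ i, (m i : ℝ) • β i‖) ^ (Fintype.card ι + 1))⁻¹‖
    ≤ ‖c.equivFun.symm m‖⁻¹ ^ (Fintype.card ι + 1)
  rw [← hc, Real.norm_of_nonneg (by positivity), ← inv_pow]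
  gcongr
  linarith

theorem inv_one_add_norm_add_pow_le {E : Type*} [SeminormedAddCommGroup E] (x y : E) (N : ℕ) :
    ((1 + ‖x + y‖) ^ N)⁻¹ ≤ (1 + ‖x‖) ^ N * ((1 + ‖y‖) ^ N)⁻¹ := by
  rw [← div_eq_mul_inv, le_div_iff₀ (by positivity), inv_mul_le_iff₀ (by positivity), ← mul_pow]
  gcongr
  have h : ‖y‖ ≤ ‖x + y‖ + ‖x‖ := by
    simpa using norm_sub_le (x + y) x
  nlinarith [norm_nonneg x, norm_nonneg (x + y), mul_nonneg (norm_nonneg (x + y)) (norm_nonneg x)]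

variable {ι : Type*} [Fintype ι]

/-- A decaying function is dominated on integer translates of a ball, uniformly in the ball. -/
theorem norm_intCast_le_of_decay {h : (ι → ℝ) → ℂ} {K : ℝ} {N : ℕ}
    (hK : ∀ x, ‖h x‖ ≤ K * ((1 + ‖x‖) ^ N)⁻¹) {R : ℝ} {t : ι → ℝ} (ht : ‖t‖ ≤ R) (m : ι → ℤ) :
    ‖h (t + fun i => (m i : ℝ))‖
      ≤ K * (1 + R) ^ N * ((1 + ‖fun i => (m i : ℝ)‖) ^ N)⁻¹ := by
  have hK0 : 0 ≤ K := by
    have := (norm_nonneg _).trans (hK 0)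
    simpa using this
  refine (hK _).trans ?_
  rw [mul_assoc]
  refine mul_le_mul_of_nonneg_left ((inv_one_add_norm_add_pow_le _ _ _).trans ?_) hK0
  gcongr

theorem summable_inv_one_add_norm_intCast :
    Summable fun m : ι → ℤ => ((1 + ‖fun i => (m i : ℝ)‖) ^ (Fintype.card ι + 1))⁻¹ := by
  classical
  refine (summable_lattice_decay (Pi.basisFun ℝ ι)).congr fun m => ?_
  congr 4
  ext j
  simp [Finset.sum_apply, Pi.single_apply]

/-- The periodisation of a decaying function is a continuous function on the torus. -/
theorem exists_torus_periodization {h : (ι → ℝ) → ℂ} (hc : Continuous h) {K : ℝ}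
    (hK : ∀ x, ‖h x‖ ≤ K * ((1 + ‖x‖) ^ (Fintype.card ι + 1))⁻¹) :
    ∃ F : C(UnitAddTorus ι, ℂ), ∀ t : ι → ℝ,
      F (fun i => (t i : UnitAddCircle)) = ∑' m : ι → ℤ, h (t + fun i => (m i : ℝ)) := by
  let f : (ι → ℝ) → ℂ := fun t => ∑' m : ι → ℤ, h (t + fun i => (m i : ℝ))
  have hf : Continuous f := by
    rw [continuous_iff_continuousAt]
    intro t
    have : ContinuousOn f (Metric.ball 0 (‖t‖ + 1)) := by
      refine continuousOn_tsum (fun m => by fun_prop)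
        (summable_inv_one_add_norm_intCast.mul_left (K * (1 + (‖t‖ + 1)) ^ (Fintype.card ι + 1)))
        fun m x hx => norm_intCast_le_of_decay hK ?_ m
      simpa using (Metric.mem_ball.mp hx).le
    exact this.continuousAt (Metric.isOpen_ball.mem_nhds (by simp))
  have hper : ∀ (t : ι → ℝ) (k : ι → ℤ), f (t + fun i => (k i : ℝ)) = f t := by
    intro t k
    refine ((Equiv.addLeft k).tsum_eq fun m => h (t + fun i => (m i : ℝ))).symm.trans ?_ |>.symm
    refine tsum_congr fun m => congrArg h ?_
    ext i
    simp [add_assoc]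
  let q : (ι → ℝ) → UnitAddTorus ι := fun t i => (t i : UnitAddCircle)
  have hq : IsOpenQuotientMap q :=
    IsOpenQuotientMap.piMap fun _ => QuotientAddGroup.isOpenQuotientMap_mk
  have hfac : ∀ s t, q s = q t → f s = f t := by
    intro s t hst
    have : ∀ i, ∃ k : ℤ, s i = t i + k := by
      intro i
      have hi : ((s i - t i : ℝ) : UnitAddCircle) = 0 := by
        rw [AddCircle.coe_sub, sub_eq_zero]
        exact congrFun hst i
      obtain ⟨k, hk⟩ := (AddCircle.coe_eq_zero_iff 1).mp hi
      exact ⟨k, by rw [zsmul_one] at hk; linarith⟩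
    choose k hk using this
    rw [← hper t k]
    exact congrArg f (funext hk)
  refine ⟨⟨Function.extend q f 0, ?_⟩, fun t => ?_⟩
  · rw [hq.isQuotientMap.continuous_iff]
    convert hf using 1
    ext t
    exact Function.FactorsThrough.extend_apply (fun a b => hfac a b) _ _
  · exact Function.FactorsThrough.extend_apply (g := f) (fun a b => hfac a b) _ _

theorem mFourier_coe (k : ι → ℤ) (t : ι → ℝ) :
    UnitAddTorus.mFourier k (fun i => (t i : UnitAddCircle))
      = Complex.exp (2 * Real.pi * Complex.I * ((∑ i, (k i : ℝ) * t i : ℝ) : ℂ)) := by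
  simp only [UnitAddTorus.mFourier, ContinuousMap.coe_mk, fourier_coe_apply]
  rw [← Complex.exp_sum]
  congr 1
  push_cast
  rw [Finset.mul_sum]
  refine Finset.sum_congr rfl fun i _ => ?_
  ring

/-- Unfolding of an integral over `ℝ^ι` along `ℤ^ι`. The cube is half-open on the left, as in
`UnitAddTorus.mFourierCoeff_eq_integral`. -/
theorem integral_eq_tsum_setIntegral_cube {g : (ι → ℝ) → ℂ} (hg : Integrable g) :
    ∫ x, g x = ∑' m : ι → ℤ,
      ∫ x in {x : ι → ℝ | ∀ i, x i ∈ Set.Ioc ((0 : ι → ℝ) i) ((0 : ι → ℝ) i + 1)},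
        g (x + fun i => (m i : ℝ)) := by
  classical
  let b := Pi.basisFun ℝ ι
  have : VAddInvariantMeasure (Submodule.span ℤ (Set.range b)) (ι → ℝ) volume :=
    inferInstanceAs <|
      VAddInvariantMeasure (Submodule.span ℤ (Set.range b)).toAddSubgroup (ι → ℝ) volume
  have h1 := (ZSpan.isAddFundamentalDomain b (volume : Measure (ι → ℝ))).integral_eq_tsum'' g hg
  rw [h1, ← ((b.restrictScalars ℤ).equivFun.symm.toEquiv).tsum_eq]
  refine tsum_congr fun m => ?_
  have hset : ZSpan.fundamentalDomain b =ᵐ[volume]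
      {x : ι → ℝ | ∀ i, x i ∈ Set.Ioc ((0 : ι → ℝ) i) ((0 : ι → ℝ) i + 1)} := by
    rw [ZSpan.fundamentalDomain_pi_basisFun]
    have e1 := Measure.univ_pi_Ico_ae_eq_Icc (μ := fun _ : ι => (volume : Measure ℝ))
      (f := fun _ => 0) (g := fun _ => 1)
    have e2 := Measure.univ_pi_Ioc_ae_eq_Icc (μ := fun _ : ι => (volume : Measure ℝ))
      (f := fun _ => 0) (g := fun _ => 1)
    refine (e1.trans e2.symm).trans (Filter.EventuallyEq.of_eq ?_)
    ext x
    change x ∈ Set.univ.pi (fun _ => Set.Ioc (0 : ℝ) 1) ↔ _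
    simp only [Set.mem_univ_pi, Pi.zero_apply, zero_add]
    rfl
  rw [setIntegral_congr_set hset]
  refine setIntegral_congr_fun (MeasurableSet.univ_pi' fun i => measurableSet_Ioc) fun x _ => ?_
  have : (((b.restrictScalars ℤ).equivFun.symm m : _) : ι → ℝ) = fun i => (m i : ℝ) := by
    rw [Module.Basis.equivFun_symm_apply, Submodule.coe_sum]
    ext j
    simp [b, Finset.sum_apply, Pi.single_apply]
  change g (((b.restrictScalars ℤ).equivFun.symm m : ι → ℝ) + x) = _
  rw [this, add_comm]

/-- **Poisson summation** for a continuous function on `ℝ^ι` with polynomial decay and summable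
Fourier transform on the integer points. -/
theorem tsum_add_intCast_eq_tsum_fourier {h : (ι → ℝ) → ℂ} (hc : Continuous h) {K : ℝ}
    (hK : ∀ x, ‖h x‖ ≤ K * ((1 + ‖x‖) ^ (Fintype.card ι + 1))⁻¹)
    {c : (ι → ℤ) → ℂ}
    (hF : ∀ k : ι → ℤ, ∫ x : ι → ℝ,
      Complex.exp (-(2 * Real.pi * Complex.I * ((∑ i, (k i : ℝ) * x i : ℝ) : ℂ))) * h x = c k)
    (hs : Summable c) (t : ι → ℝ) :
    ∑' m : ι → ℤ, h (t + fun i => (m i : ℝ))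
      = ∑' k : ι → ℤ, c k *
        Complex.exp (2 * Real.pi * Complex.I * ((∑ i, (k i : ℝ) * t i : ℝ) : ℂ)) := by
  obtain ⟨F, hFt⟩ := exists_torus_periodization hc hK
  have hint : Integrable h := by
    have h1 := (integrable_one_add_norm (E := ι → ℝ) (μ := volume)
      (r := (Fintype.card ι + 1 : ℕ)) (by simp)).const_mul K
    refine h1.mono' hc.aestronglyMeasurable (Filter.Eventually.of_forall fun x => ?_)
    rw [Real.rpow_neg (by positivity), Real.rpow_natCast]
    exact hK x
  let ch : (ι → ℤ) → (ι → ℝ) → ℂ := fun k x =>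
    Complex.exp (-(2 * Real.pi * Complex.I * ((∑ i, (k i : ℝ) * x i : ℝ) : ℂ)))
  have hch : ∀ k x, ‖ch k x‖ = 1 := by
    intro k x
    have : -(2 * Real.pi * Complex.I * ((∑ i, (k i : ℝ) * x i : ℝ) : ℂ))
        = ((-(2 * Real.pi * ∑ i, (k i : ℝ) * x i) : ℝ) : ℂ) * Complex.I := by
      push_cast
      ring
    simp only [ch]
    rw [this, Complex.norm_exp_ofReal_mul_I]
  have hchc : ∀ k, Continuous (ch k) := fun k => by
    simp only [ch]
    fun_prop
  have hchm : ∀ k x (m : ι → ℤ), ch k (x + fun i => (m i : ℝ)) = ch k x := by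
    intro k x m
    simp only [ch]
    rw [Complex.exp_eq_exp_iff_exists_int]
    refine ⟨-∑ i, k i * m i, ?_⟩
    push_cast [Pi.add_apply, mul_add, Finset.sum_add_distrib]
    ring
  have hgint : ∀ k, Integrable fun x => ch k x * h x := fun k =>
    hint.bdd_mul (hchc k).aestronglyMeasurable (c := 1)
      (Filter.Eventually.of_forall fun x => (hch k x).le)
  have hcoeff : ∀ k, UnitAddTorus.mFourierCoeff F k = c k := by
    intro k
    rw [UnitAddTorus.mFourierCoeff_eq_integral F k 0, ← hF k,
      integral_eq_tsum_setIntegral_cube (hgint k)]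
    set C := {x : ι → ℝ | ∀ i, x i ∈ Set.Ioc ((0 : ι → ℝ) i) ((0 : ι → ℝ) i + 1)} with hC
    have hCm : MeasurableSet C := MeasurableSet.univ_pi' fun i => measurableSet_Ioc
    have hCb : ∀ x ∈ C, ‖x‖ ≤ 1 := by
      intro x hx
      refine (pi_norm_le_iff_of_nonneg zero_le_one).mpr fun i => ?_
      have := hx i
      simp only [Pi.zero_apply, zero_add, Set.mem_Ioc] at this
      rw [Real.norm_of_nonneg this.1.le]
      exact this.2
    have hCfin : volume C < ⊤ :=
      (Metric.isBounded_iff_subset_closedBall (0 : ι → ℝ) |>.mpr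
        ⟨1, fun x hx => by simpa using hCb x hx⟩).measure_lt_top
    have hi : ∀ m : ι → ℤ, Integrable (fun x => ch k (x + fun i => (m i : ℝ)) *
        h (x + fun i => (m i : ℝ))) (volume.restrict C) := fun m =>
      ((hgint k).comp_add_right _).restrict
    rw [integral_tsum_of_summable_integral_norm hi]
    · refine setIntegral_congr_fun hCm fun x _ => ?_
      simp only [hchm, tsum_mul_left, smul_eq_mul, mFourier_coe, hFt]
      congr 1
      simp only [ch]
      congr 1
      push_cast [Pi.neg_apply, neg_mul, Finset.sum_neg_distrib]
      ring
    · refine Summable.of_nonneg_of_le (fun m => integral_nonneg fun x => norm_nonneg _)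
        (fun m => ?_) ((summable_inv_one_add_norm_intCast (ι := ι)).mul_left
          (K * (1 + 1) ^ (Fintype.card ι + 1) * (volume C).toReal))
      have : ∀ x ∈ C, ‖‖ch k (x + fun i => (m i : ℝ)) * h (x + fun i => (m i : ℝ))‖‖
          ≤ K * (1 + 1) ^ (Fintype.card ι + 1) *
            ((1 + ‖fun i => (m i : ℝ)‖) ^ (Fintype.card ι + 1))⁻¹ := by
        intro x hx
        rw [norm_norm, norm_mul, hch, one_mul]
        exact norm_intCast_le_of_decay hK (hCb x hx) m
      refine (le_abs_self _).trans ((norm_setIntegral_le_of_norm_le_const hCfin this).trans ?_)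
      rw [Measure.real]
      exact le_of_eq (by ring)
  have hsum : Summable (UnitAddTorus.mFourierCoeff F) := hs.congr fun k => (hcoeff k).symm
  have := UnitAddTorus.hasSum_mFourier_series_apply_of_summable hsum
    (fun i => (t i : UnitAddCircle))
  rw [hFt] at this
  rw [← this.tsum_eq]
  refine tsum_congr fun k => ?_
  rw [hcoeff, mFourier_coe, smul_eq_mul]

end Poisson

/-! ### Theta inversion for Gaussians -/

section Gaussian

open MeasureTheory

theorem im_neg_one_div_pos {τ : ℂ} (hτ : 0 < τ.im) : 0 < (-1 / τ).im := by
  have hτ0 : τ ≠ 0 := fun h => by simp [h] at hτ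
  have h : 0 < τ.im / Complex.normSq τ := div_pos hτ (Complex.normSq_pos.mpr hτ0)
  rw [Complex.div_im]
  simpa [neg_div] using h

theorem exists_one_add_pow_mul_exp_le (N : ℕ) {a : ℝ} (ha : 0 < a) :
    ∃ K : ℝ, ∀ x : ℝ, 0 ≤ x → (1 + x) ^ N * Real.exp (-(a * x ^ 2)) ≤ K := by
  refine ⟨N.factorial * Real.exp (1 + 1 / (4 * a)), fun x hx => ?_⟩
  have h1 : (1 + x) ^ N ≤ N.factorial * Real.exp (1 + x) := by
    have := Real.pow_div_factorial_le_exp (1 + x) (by positivity) N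
    rwa [div_le_iff₀' (by positivity)] at this
  have h2 : 1 + x + -(a * x ^ 2) ≤ 1 + 1 / (4 * a) := by
    have : 1 / (4 * a) - x + a * x ^ 2 = (2 * a * x - 1) ^ 2 / (4 * a) := by
      field_simp
      ring
    have : 0 ≤ (2 * a * x - 1) ^ 2 / (4 * a) := by positivity
    linarith
  calc (1 + x) ^ N * Real.exp (-(a * x ^ 2))
      ≤ N.factorial * Real.exp (1 + x) * Real.exp (-(a * x ^ 2)) := by gcongr
    _ = N.factorial * Real.exp (1 + x + -(a * x ^ 2)) := by rw [mul_assoc, ← Real.exp_add]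
    _ ≤ _ := by gcongr

variable {E : Type*} [NormedAddCommGroup E]

/-- The Gaussian `v ↦ exp(πiσ‖v‖²)`. -/
def gaussian (σ : ℂ) (v : E) : ℂ := Complex.exp (Real.pi * Complex.I * σ * ((‖v‖ ^ 2 : ℝ) : ℂ))

theorem norm_gaussian (σ : ℂ) (v : E) :
    ‖gaussian σ v‖ = Real.exp (-(Real.pi * σ.im * ‖v‖ ^ 2)) := by
  rw [gaussian, Complex.norm_exp]
  congr 1
  simp [-Complex.ofReal_pow]

theorem continuous_gaussian (σ : ℂ) : Continuous (gaussian (E := E) σ) := by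
  unfold gaussian
  fun_prop

theorem exists_norm_gaussian_le (N : ℕ) {σ : ℂ} (hσ : 0 < σ.im) :
    ∃ K : ℝ, ∀ v : E, (1 + ‖v‖) ^ N * ‖gaussian σ v‖ ≤ K := by
  obtain ⟨K, hK⟩ := exists_one_add_pow_mul_exp_le N (mul_pos Real.pi_pos hσ)
  exact ⟨K, fun v => by rw [norm_gaussian]; exact hK _ (norm_nonneg v)⟩

variable [InnerProductSpace ℝ E]

/-- The Fourier transform of a Gaussian. As the dimension `2r` is even, the factor `(-iτ)^{n/2}` is
an integral power and no branch has to be chosen. -/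
theorem gaussian_fourier [FiniteDimensional ℝ E] [MeasurableSpace E] [BorelSpace E] {r : ℕ}
    (hr : Module.finrank ℝ E = 2 * r) {τ : ℂ} (hτ : 0 < τ.im) (w : E) :
    ∫ v : E, Complex.exp (-(2 * Real.pi * Complex.I * ((inner ℝ w v : ℝ) : ℂ))) *
      gaussian (-1 / τ) v = (-Complex.I * τ) ^ r * gaussian τ w := by
  have hτ0 : τ ≠ 0 := fun h => by simp [h] at hτ
  have hpi : (Real.pi : ℂ) ≠ 0 := by exact_mod_cast Real.pi_ne_zero
  set b : ℂ := Real.pi * Complex.I / τ with hb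
  have hbre : 0 < b.re := by
    have : b = Real.pi * (Complex.I / τ) := by rw [hb]; ring
    rw [this, Complex.re_ofReal_mul, Complex.div_re]
    simp only [Complex.I_re, Complex.I_im, zero_mul, one_mul, zero_div, zero_add]
    have := Complex.normSq_pos.mpr hτ0
    positivity
  have key := GaussianFourier.integral_cexp_neg_mul_sq_norm_add hbre
    (-(2 * Real.pi * Complex.I)) w
  have e1 : (Real.pi : ℂ) / b = -Complex.I * τ := by
    rw [hb]
    field_simp
    rw [Complex.I_sq]
    ring
  have e2 : ((Module.finrank ℝ E : ℕ) : ℂ) / 2 = (r : ℂ) := by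
    rw [hr]
    push_cast
    ring
  rw [e1, e2, Complex.cpow_natCast] at key
  convert key using 1
  · congr 1
    ext v
    rw [gaussian, ← Complex.exp_add]
    congr 1
    rw [hb]
    push_cast
    field_simp
    ring
  · rw [gaussian]
    congr 2
    rw [hb]
    push_cast
    field_simp
    ring

/-- **Theta inversion** for a lattice `⊕ ℤ β i` in a Euclidean space of even dimension `2r`; the
vectors `β' i` span the dual lattice. The constant `D` is the inverse covolume; only
its positivity matters below. -/
theorem exists_gaussian_poisson [FiniteDimensional ℝ E] {ι : Type*} [Fintype ι] [DecidableEq ι]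
    (β : Module.Basis ι ℝ E) (β' : Module.Basis ι ℝ E)
    (hdual : ∀ i j, inner ℝ (β' i) (β j) = if i = j then (1 : ℝ) else 0) {r : ℕ}
    (hr : Module.finrank ℝ E = 2 * r) :
    ∃ D : ℝ, 0 < D ∧ ∀ τ : ℂ, 0 < τ.im → ∀ z : E,
      ∑' m : ι → ℤ, gaussian (-1 / τ) (z + ∑ i, (m i : ℝ) • β i)
        = D * (-Complex.I * τ) ^ r * ∑' k : ι → ℤ, gaussian τ (∑ i, (k i : ℝ) • β' i) *
          Complex.exp (2 * Real.pi * Complex.I *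
            ((inner ℝ (∑ i, (k i : ℝ) • β' i) z : ℝ) : ℂ)) := by
  borelize E
  -- `c` compares the Lebesgue measure in the coordinates of `β` with the volume of `E`
  let φ : (ι → ℝ) ≃L[ℝ] E := β.equivFunL.symm
  have hφ : ∀ x, φ x = ∑ i, x i • β i := fun x => by
    exact β.equivFun_symm_apply x
  have : (Measure.map φ (volume : Measure (ι → ℝ))).IsAddHaarMeasure :=
    φ.isAddHaarMeasure_map _
  set c := Measure.addHaarScalarFactor (Measure.map φ (volume : Measure (ι → ℝ)))
    (volume : Measure E)
  have hc := Measure.isAddLeftInvariant_eq_smul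
    (Measure.map φ (volume : Measure (ι → ℝ))) (volume : Measure E)
  refine ⟨c, NNReal.coe_pos.mpr (Measure.addHaarScalarFactor_pos_of_isAddHaarMeasure _ _),
    fun τ hτ z => ?_⟩
  have hσ : 0 < (-1 / τ).im := im_neg_one_div_pos hτ
  have hinner : ∀ (k : ι → ℤ) (x : ι → ℝ),
      inner ℝ (∑ i, (k i : ℝ) • β' i) (φ x) = ∑ i, (k i : ℝ) * x i := by
    intro k x
    rw [hφ, sum_inner]
    refine Finset.sum_congr rfl fun i _ => ?_
    simp [inner_sum, inner_smul_left, inner_smul_right, hdual, mul_comm]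
  obtain ⟨K, hK⟩ := exists_norm_gaussian_le (E := E) (Fintype.card ι + 1) hσ
  let C := ‖(φ.symm : E →L[ℝ] (ι → ℝ))‖
  have hC : ∀ x, ‖x‖ ≤ C * ‖φ x‖ := fun x => by
    simpa using (φ.symm : E →L[ℝ] (ι → ℝ)).le_opNorm (φ x)
  have hdecay : ∀ x : ι → ℝ, ‖gaussian (-1 / τ) (φ x)‖
      ≤ ((1 + C) ^ (Fintype.card ι + 1) * K) * ((1 + ‖x‖) ^ (Fintype.card ι + 1))⁻¹ := by
    intro x
    rw [← div_eq_mul_inv, le_div_iff₀ (by positivity)]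
    have h1 : 1 + ‖x‖ ≤ (1 + C) * (1 + ‖φ x‖) := by
      have : 0 ≤ C := norm_nonneg _
      nlinarith [hC x, norm_nonneg (φ x)]
    calc ‖gaussian (-1 / τ) (φ x)‖ * (1 + ‖x‖) ^ (Fintype.card ι + 1)
        ≤ ‖gaussian (-1 / τ) (φ x)‖ * ((1 + C) * (1 + ‖φ x‖)) ^ (Fintype.card ι + 1) := by gcongr
      _ = (1 + C) ^ (Fintype.card ι + 1) *
          ((1 + ‖φ x‖) ^ (Fintype.card ι + 1) * ‖gaussian (-1 / τ) (φ x)‖) := by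
        rw [mul_pow]; ring
      _ ≤ _ := by
        have : 0 ≤ C := norm_nonneg _
        gcongr
        exact hK _
  have hF : ∀ k : ι → ℤ, ∫ x : ι → ℝ,
      Complex.exp (-(2 * Real.pi * Complex.I * ((∑ i, (k i : ℝ) * x i : ℝ) : ℂ))) *
        gaussian (-1 / τ) (φ x)
      = (c : ℝ) * ((-Complex.I * τ) ^ r * gaussian τ (∑ i, (k i : ℝ) • β' i)) := by
    intro k
    have h1 := integral_map_equiv (μ := (volume : Measure (ι → ℝ)))
      φ.toHomeomorph.toMeasurableEquiv fun v : E =>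
        Complex.exp (-(2 * Real.pi * Complex.I *
          ((inner ℝ (∑ i, (k i : ℝ) • β' i) v : ℝ) : ℂ))) * gaussian (-1 / τ) v
    have h2 : Measure.map φ.toHomeomorph.toMeasurableEquiv (volume : Measure (ι → ℝ))
        = c • volume := hc
    rw [h2, integral_smul_nnreal_measure, gaussian_fourier hr hτ] at h1
    rw [← Complex.real_smul, ← NNReal.smul_def, h1]
    refine integral_congr_ae (Filter.Eventually.of_forall fun x => ?_)
    change _ = Complex.exp (-(2 * Real.pi * Complex.I *
      ((inner ℝ (∑ i, (k i : ℝ) • β' i) (φ x) : ℝ) : ℂ))) * gaussian (-1 / τ) (φ x)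
    rw [hinner]
  have hsum : Summable fun k : ι → ℤ =>
      ((c : ℝ) : ℂ) * ((-Complex.I * τ) ^ r * gaussian τ (∑ i, (k i : ℝ) • β' i)) := by
    refine Summable.mul_left _ (Summable.mul_left _ ?_)
    obtain ⟨K', hK'⟩ := exists_norm_gaussian_le (E := E) (Fintype.card ι + 1) hτ
    refine Summable.of_norm_bounded ((summable_lattice_decay β').mul_left K') fun k => ?_
    rw [← div_eq_mul_inv, le_div_iff₀ (by positivity), mul_comm]
    exact hK' _
  have key := tsum_add_intCast_eq_tsum_fourier
    ((continuous_gaussian (-1 / τ)).comp φ.continuous) hdecay hF hsum (φ.symm z)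
  have hl : ∀ m : ι → ℤ, φ (φ.symm z + fun i => (m i : ℝ)) = z + ∑ i, (m i : ℝ) • β i := by
    intro m
    rw [map_add, φ.apply_symm_apply, hφ]
  simp only [Function.comp_apply, hl] at key
  rw [key, ← tsum_mul_left]
  refine tsum_congr fun k => ?_
  rw [← hinner, φ.apply_symm_apply]
  ring

end Gaussian

/-! ### Laplacians on polynomials -/

section Harmonic

open MvPolynomial

variable {J : Type*}

theorem pderiv_comm (j k : J) (P : MvPolynomial J ℂ) :
    pderiv j (pderiv k P) = pderiv k (pderiv j P) := by
  classical
  -- the commutator is a derivation that vanishes on the variables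
  have : ⁅(pderiv j : Derivation ℂ (MvPolynomial J ℂ) (MvPolynomial J ℂ)),
      (pderiv k : Derivation ℂ (MvPolynomial J ℂ) (MvPolynomial J ℂ))⁆ = 0 := by
    refine derivation_ext fun i => ?_
    simp [Derivation.commutator_apply, pderiv_X, Pi.single_apply, apply_ite]
  have h := congrArg (fun D => D P) this
  simpa [Derivation.commutator_apply, sub_eq_zero] using h

variable [Fintype J]

/-- The derivation `∑ k, K j k ∂/∂ξₖ`. -/
def dirDeriv (K : J → J → ℂ) (j : J) : Derivation ℂ (MvPolynomial J ℂ) (MvPolynomial J ℂ) :=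
  ∑ k, K j k • pderiv k

/-- The Laplacian `∑ j k, K j k ∂²/∂ξⱼ∂ξₖ`. -/
def laplacian (K : J → J → ℂ) : Module.End ℂ (MvPolynomial J ℂ) :=
  ∑ j, (dirDeriv K j).toLinearMap ∘ₗ (pderiv j).toLinearMap

theorem laplacian_apply (K : J → J → ℂ) (P : MvPolynomial J ℂ) :
    laplacian K P = ∑ j, dirDeriv K j (pderiv j P) := by
  simp [laplacian]

theorem dirDeriv_apply (K : J → J → ℂ) (j : J) (P : MvPolynomial J ℂ) :
    dirDeriv K j P = ∑ k, K j k • pderiv k P := by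
  have h := map_sum (Derivation.coeFnAddMonoidHom (R := ℂ) (A := MvPolynomial J ℂ)
    (M := MvPolynomial J ℂ)) (fun k => K j k • pderiv k) Finset.univ
  have h' := congrFun h P
  rw [Finset.sum_apply] at h'
  exact h'

theorem dirDeriv_X (K : J → J → ℂ) (j i : J) : dirDeriv K j (X i) = C (K j i) := by
  classical
  rw [dirDeriv_apply, Finset.sum_eq_single i]
  · simp [smul_eq_C_mul]
  · intro k _ hk
    simp [pderiv_X_of_ne hk.symm]
  · simp

theorem dirDeriv_pderiv_comm (K : J → J → ℂ) (j k : J) (P : MvPolynomial J ℂ) :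
    dirDeriv K j (pderiv k P) = pderiv k (dirDeriv K j P) := by
  simp only [dirDeriv_apply, map_sum, Derivation.map_smul, pderiv_comm k]

theorem dirDeriv_comm (K : J → J → ℂ) (i j : J) (P : MvPolynomial J ℂ) :
    dirDeriv K i (dirDeriv K j P) = dirDeriv K j (dirDeriv K i P) := by
  simp only [dirDeriv_apply K j, map_sum, Derivation.map_smul, dirDeriv_pderiv_comm]

theorem laplacian_dirDeriv (K : J → J → ℂ) (j : J) (P : MvPolynomial J ℂ) :
    laplacian K (dirDeriv K j P) = dirDeriv K j (laplacian K P) := by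
  simp only [laplacian_apply, map_sum, ← dirDeriv_pderiv_comm, dirDeriv_comm K _ j]

theorem laplacian_mul_X {K : J → J → ℂ} (hK : ∀ j k, K j k = K k j) (j : J)
    (P : MvPolynomial J ℂ) :
    laplacian K (P * X j) = laplacian K P * X j + (2 : ℂ) • dirDeriv K j P := by
  classical
  have h1 : ∀ i, dirDeriv K i (pderiv i (P * X j))
      = dirDeriv K i (pderiv i P) * X j + K j i • pderiv i P
        + (Pi.single (M := fun _ => MvPolynomial J ℂ) j (dirDeriv K j P) i) := by
    intro i
    rw [Derivation.leibniz, map_add, smul_eq_mul, smul_eq_mul, pderiv_X, Derivation.leibniz,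
      Derivation.leibniz, dirDeriv_X, hK i j]
    by_cases h : i = j
    · subst h
      simp [smul_eq_C_mul]
      ring
    · simp [h, smul_eq_C_mul, Ne.symm h]
      ring
  rw [laplacian_apply]
  simp only [h1, Finset.sum_add_distrib, ← Finset.sum_mul, ← laplacian_apply, ← dirDeriv_apply]
  rw [Finset.sum_pi_single', two_smul]
  simp [add_assoc]

/-- The commutation relation `[Δ^{l+1}, Xⱼ] = 2(l+1) Dⱼ Δ^l`. -/
theorem laplacian_pow_succ_mul_X {K : J → J → ℂ} (hK : ∀ j k, K j k = K k j) (j : J)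
    (P : MvPolynomial J ℂ) (l : ℕ) :
    (laplacian K ^ (l + 1)) (P * X j)
      = (laplacian K ^ (l + 1)) P * X j
        + (2 * (l + 1) : ℂ) • dirDeriv K j ((laplacian K ^ l) P) := by
  induction l with
  | zero => simp [laplacian_mul_X hK]
  | succ l ih =>
    rw [pow_succ', Module.End.mul_apply, ih, map_add, laplacian_mul_X hK, map_smul,
      laplacian_dirDeriv, ← Module.End.mul_apply, ← Module.End.mul_apply, ← pow_succ', ← pow_succ',
      add_assoc, ← add_smul]
    push_cast
    ring_nf

/-- The truncated heat operator `∑ l < N, cˡ/l! Δˡ`. -/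
def heat (K : J → J → ℂ) (c : ℂ) (N : ℕ) (P : MvPolynomial J ℂ) : MvPolynomial J ℂ :=
  ∑ l ∈ Finset.range N, (c ^ l / l.factorial) • (laplacian K ^ l) P

theorem heat_eq_of_le {K : J → J → ℂ} {c : ℂ} {N N' : ℕ} {P : MvPolynomial J ℂ}
    (hP : (laplacian K ^ N) P = 0) (h : N ≤ N') : heat K c N' P = heat K c N P := by
  refine (Finset.sum_subset (Finset.range_mono h) fun l _ hl => ?_).symm
  rw [Module.End.pow_map_zero_of_le (by simpa using hl) hP, smul_zero]

theorem heat_add (K : J → J → ℂ) (c : ℂ) (N : ℕ) (P P' : MvPolynomial J ℂ) :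
    heat K c N (P + P') = heat K c N P + heat K c N P' := by
  simp [heat, Finset.sum_add_distrib]

/-- The commutation relation `[exp(cΔ), Xⱼ] = 2c Dⱼ exp(cΔ)`, in truncated form. -/
theorem heat_succ_mul_X {K : J → J → ℂ} (hK : ∀ j k, K j k = K k j) (j : J) (c : ℂ) (N : ℕ)
    (P : MvPolynomial J ℂ) :
    heat K c (N + 1) (P * X j)
      = heat K c (N + 1) P * X j + (2 * c) • dirDeriv K j (heat K c N P) := by
  simp only [heat, Finset.sum_range_succ' _ N, laplacian_pow_succ_mul_X hK, smul_add, add_mul,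
    Finset.sum_add_distrib, Finset.sum_mul, map_sum, Finset.smul_sum, Derivation.map_smul,
    smul_mul_assoc]
  rw [add_right_comm]
  congr 1
  refine Finset.sum_congr rfl fun l _ => ?_
  rw [smul_smul, smul_smul]
  congr 1
  rw [Nat.factorial_succ]
  have : ((l : ℂ) + 1) ≠ 0 := by exact_mod_cast Nat.succ_ne_zero l
  have : (l.factorial : ℂ) ≠ 0 := by exact_mod_cast l.factorial_ne_zero
  push_cast
  field_simp
  ring

theorem eval_const_mul_of_isHomogeneous {κ : Type*} {P : MvPolynomial κ ℂ} {ν : ℕ}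
    (hP : P.IsHomogeneous ν) (a : ℂ) (x : κ → ℂ) :
    eval (fun j => a * x j) P = a ^ ν * eval x P := by
  rw [eval_eq, eval_eq, Finset.mul_sum]
  refine Finset.sum_congr rfl fun s hs => ?_
  have h := hP (mem_support_iff.mp hs)
  rw [Finsupp.weight_apply, Finsupp.sum] at h
  simp only [mul_pow, Finset.prod_mul_distrib, Finset.prod_pow_eq_pow_sum]
  have h' : ∑ i ∈ s.support, s i = ν := by simpa using h
  rw [h']
  ring

end Harmonic

/-! ### Polynomials times Gaussians -/

section HarmonicGaussian

open MvPolynomial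

variable {J : Type*} {E : Type*} [NormedAddCommGroup E] [InnerProductSpace ℝ E]

/-- The value at `v` of the polynomial `P` in the coordinates `ξⱼ = ⟪d j, ·⟫`, scaled by `a`. -/
def polyAt (d : J → E) (a : ℂ) (P : MvPolynomial J ℂ) (v : E) : ℂ :=
  eval (fun j => a * ((inner ℝ (d j) v : ℝ) : ℂ)) P

/-- The Gram matrix of the vectors `d j`. -/
def gram (d : J → E) (j k : J) : ℂ := ((inner ℝ (d j) (d k) : ℝ) : ℂ)

theorem gram_symm (d : J → E) (j k : J) : gram d j k = gram d k j := by
  rw [gram, gram, real_inner_comm]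

theorem hasDerivAt_inner_line (w z v : E) (t : ℝ) :
    HasDerivAt (fun t : ℝ => ((inner ℝ w (z + t • v) : ℝ) : ℂ)) ((inner ℝ w v : ℝ) : ℂ) t := by
  have h : (fun t : ℝ => inner ℝ w (z + t • v)) = fun t => inner ℝ w z + t * inner ℝ w v := by
    ext t
    rw [inner_add_right, inner_smul_right]
  have h2 : HasDerivAt (fun t : ℝ => inner ℝ w (z + t • v)) (inner ℝ w v) t := by
    rw [h]
    simpa using ((hasDerivAt_id t).mul_const (inner ℝ w v)).const_add (inner ℝ w z)
  exact h2.ofReal_comp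

theorem hasDerivAt_gaussian (σ : ℂ) (z v : E) (t : ℝ) :
    HasDerivAt (fun t : ℝ => gaussian σ (z + t • v))
      (2 * Real.pi * Complex.I * σ * ((inner ℝ v (z + t • v) : ℝ) : ℂ) * gaussian σ (z + t • v))
      t := by
  have h1 : HasDerivAt (fun t : ℝ => z + t • v) v t := by
    simpa using ((hasDerivAt_id t).smul_const v).const_add z
  have h2 := (h1.norm_sq.ofReal_comp.const_mul (Real.pi * Complex.I * σ)).cexp
  refine HasDerivAt.congr_deriv (f := fun t : ℝ => gaussian σ (z + t • v)) h2 ?_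
  rw [real_inner_comm]
  simp only [gaussian]
  push_cast
  ring

/-- A polynomial times a Gaussian. -/
def polyGauss (d : J → E) (a σ : ℂ) (P : MvPolynomial J ℂ) (v : E) : ℂ :=
  polyAt d a P v * gaussian σ v

theorem exists_norm_polyAt_le (d : J → E) (a : ℂ) (P : MvPolynomial J ℂ) :
    ∃ (B : ℝ) (n : ℕ), 0 ≤ B ∧ ∀ v, ‖polyAt d a P v‖ ≤ B * (1 + ‖v‖) ^ n := by
  induction P using MvPolynomial.induction_on with
  | C c => exact ⟨‖c‖, 0, norm_nonneg _, fun v => by simp [polyAt]⟩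
  | add P P' h h' =>
    obtain ⟨B, n, hB, h⟩ := h
    obtain ⟨B', n', hB', h'⟩ := h'
    refine ⟨B + B', n + n', by positivity, fun v => ?_⟩
    have h1 : (1 : ℝ) ≤ 1 + ‖v‖ := by linarith [norm_nonneg v]
    calc ‖polyAt d a (P + P') v‖ ≤ ‖polyAt d a P v‖ + ‖polyAt d a P' v‖ := by
          simpa [polyAt] using norm_add_le _ _
      _ ≤ B * (1 + ‖v‖) ^ (n + n') + B' * (1 + ‖v‖) ^ (n + n') := by
          refine add_le_add ((h v).trans ?_) ((h' v).trans ?_)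
          · exact mul_le_mul_of_nonneg_left (pow_le_pow_right₀ h1 (by omega)) hB
          · exact mul_le_mul_of_nonneg_left (pow_le_pow_right₀ h1 (by omega)) hB'
      _ = _ := by ring
  | mul_X P i h =>
    obtain ⟨B, n, hB, h⟩ := h
    refine ⟨B * (‖a‖ * ‖d i‖), n + 1, by positivity, fun v => ?_⟩
    have h1 : ‖((inner ℝ (d i) v : ℝ) : ℂ)‖ ≤ ‖d i‖ * (1 + ‖v‖) := by
      rw [Complex.norm_real]
      refine (norm_inner_le_norm _ _).trans ?_
      gcongr
      linarith
    have e : polyAt d a (P * X i) v = polyAt d a P v * (a * ((inner ℝ (d i) v : ℝ) : ℂ)) := by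
      simp only [polyAt, map_mul, eval_X]
    rw [e, norm_mul, norm_mul]
    calc ‖polyAt d a P v‖ * (‖a‖ * ‖((inner ℝ (d i) v : ℝ) : ℂ)‖)
        ≤ (B * (1 + ‖v‖) ^ n) * (‖a‖ * (‖d i‖ * (1 + ‖v‖))) := by gcongr; exact h v
      _ = _ := by ring

theorem exists_norm_polyGauss_le (d : J → E) (a : ℂ) {σ : ℂ} (hσ : 0 < σ.im)
    (P : MvPolynomial J ℂ) (N : ℕ) :
    ∃ K : ℝ, 0 ≤ K ∧ ∀ v, ‖polyGauss d a σ P v‖ ≤ K * ((1 + ‖v‖) ^ N)⁻¹ := by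
  obtain ⟨B, n, hB, h⟩ := exists_norm_polyAt_le d a P
  obtain ⟨K, hK⟩ := exists_norm_gaussian_le (E := E) (n + N) hσ
  have hK0 : 0 ≤ K := le_trans (by positivity) (hK 0)
  refine ⟨B * K, by positivity, fun v => ?_⟩
  rw [← div_eq_mul_inv, le_div_iff₀ (by positivity), polyGauss, norm_mul]
  calc ‖polyAt d a P v‖ * ‖gaussian σ v‖ * (1 + ‖v‖) ^ N
      ≤ (B * (1 + ‖v‖) ^ n) * ‖gaussian σ v‖ * (1 + ‖v‖) ^ N := by gcongr; exact h v
    _ = B * ((1 + ‖v‖) ^ (n + N) * ‖gaussian σ v‖) := by rw [pow_add]; ring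
    _ ≤ B * K := by gcongr; exact hK v

variable {ι : Type*} [Fintype ι]

/-- The point of the lattice spanned by `β` with integral coordinates `m`. -/
def latticePoint (β : Module.Basis ι ℝ E) (m : ι → ℤ) : E := ∑ i, (m i : ℝ) • β i

/-- A summable majorant that is uniform for `z` in a ball; it allows termwise differentiation. -/
theorem exists_summable_bound_polyGauss (β : Module.Basis ι ℝ E) (d : J → E) (a : ℂ) {σ : ℂ}
    (hσ : 0 < σ.im) (P : MvPolynomial J ℂ) (R : ℝ) :
    ∃ u : (ι → ℤ) → ℝ, Summable u ∧
      ∀ m z, ‖z‖ ≤ R → ‖polyGauss d a σ P (z + latticePoint β m)‖ ≤ u m := by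
  obtain ⟨K, hK0, hK⟩ := exists_norm_polyGauss_le d a hσ P (Fintype.card ι + 1)
  refine ⟨_, (summable_lattice_decay β).mul_left (K * (1 + R) ^ (Fintype.card ι + 1)),
    fun m z hz => (hK _).trans ?_⟩
  rw [mul_assoc]
  refine mul_le_mul_of_nonneg_left ((inv_one_add_norm_add_pow_le _ _ _).trans ?_) hK0
  rw [latticePoint]
  gcongr

theorem summable_polyGauss (β : Module.Basis ι ℝ E) (d : J → E) (a : ℂ) {σ : ℂ}
    (hσ : 0 < σ.im) (P : MvPolynomial J ℂ) (z : E) :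
    Summable fun m : ι → ℤ => polyGauss d a σ P (z + latticePoint β m) := by
  obtain ⟨u, hu, h⟩ := exists_summable_bound_polyGauss β d a hσ P ‖z‖
  exact Summable.of_norm_bounded hu fun m => h m z le_rfl

theorem norm_cexp_two_pi_I (x : ℝ) : ‖Complex.exp (2 * Real.pi * Complex.I * (x : ℂ))‖ = 1 := by
  have : 2 * Real.pi * Complex.I * (x : ℂ) = ((2 * Real.pi * x : ℝ) : ℂ) * Complex.I := by
    push_cast
    ring
  rw [this, Complex.norm_exp_ofReal_mul_I]

/-- On the Fourier side, differentiation along `d j` multiplies the coefficient polynomial by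
`Xⱼ`. -/
theorem hasDerivAt_tsum_fourier (β' : Module.Basis ι ℝ E) (d : J → E) {τ : ℂ} (hτ : 0 < τ.im)
    (j : J) (P : MvPolynomial J ℂ) (z : E) :
    HasDerivAt (fun t : ℝ => ∑' k : ι → ℤ,
        polyGauss d (2 * Real.pi * Complex.I) τ P (latticePoint β' k) *
          Complex.exp (2 * Real.pi * Complex.I *
            ((inner ℝ (latticePoint β' k) (z + t • d j) : ℝ) : ℂ)))
      (∑' k : ι → ℤ,
        polyGauss d (2 * Real.pi * Complex.I) τ (P * X j) (latticePoint β' k) *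
          Complex.exp (2 * Real.pi * Complex.I *
            ((inner ℝ (latticePoint β' k) z : ℝ) : ℂ))) 0 := by
  have hs := summable_polyGauss β' d (2 * Real.pi * Complex.I) hτ P 0
  have hs' := summable_polyGauss β' d (2 * Real.pi * Complex.I) hτ (P * X j) 0
  simp only [zero_add] at hs hs'
  have key := hasDerivAt_tsum (𝕜 := ℝ) (y₀ := 0) hs'.norm
    (g := fun k t => polyGauss d (2 * Real.pi * Complex.I) τ P (latticePoint β' k) *
          Complex.exp (2 * Real.pi * Complex.I *
            ((inner ℝ (latticePoint β' k) (z + t • d j) : ℝ) : ℂ)))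
    (g' := fun k t => polyGauss d (2 * Real.pi * Complex.I) τ (P * X j) (latticePoint β' k) *
          Complex.exp (2 * Real.pi * Complex.I *
            ((inner ℝ (latticePoint β' k) (z + t • d j) : ℝ) : ℂ)))
    (fun k t => ?_) (fun k t => ?_) ?_ 0
  · simpa using key
  · refine ((((hasDerivAt_inner_line (latticePoint β' k) z (d j) t).const_mul
      (2 * Real.pi * Complex.I)).cexp).const_mul
      (polyGauss d (2 * Real.pi * Complex.I) τ P (latticePoint β' k))).congr_deriv ?_
    rw [real_inner_comm (d j) (latticePoint β' k)]
    simp only [polyGauss, polyAt, map_mul, eval_X]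
    ring
  · rw [norm_mul, norm_cexp_two_pi_I, mul_one]
  · refine Summable.of_norm_bounded hs.norm fun k => ?_
    rw [norm_mul, norm_cexp_two_pi_I, mul_one]

variable [Fintype J]

theorem hasDerivAt_polyAt (d : J → E) (a : ℂ) (j : J) (P : MvPolynomial J ℂ) (z : E) (t : ℝ) :
    HasDerivAt (fun t : ℝ => polyAt d a P (z + t • d j))
      (a * polyAt d a (dirDeriv (gram d) j P) (z + t • d j)) t := by
  induction P using MvPolynomial.induction_on with
  | C c =>
    simp only [polyAt, Derivation.map_algebraMap, ← algebraMap_eq]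
    simpa [algebraMap_eq] using hasDerivAt_const t c
  | add P P' h h' =>
    simp only [polyAt, map_add, mul_add] at h h' ⊢
    exact h.add h'
  | mul_X P i h =>
    have h2 := h.mul ((hasDerivAt_inner_line (d i) z (d j) t).const_mul a)
    have e : a * polyAt d a (dirDeriv (gram d) j (P * X i)) (z + t • d j)
        = a * polyAt d a (dirDeriv (gram d) j P) (z + t • d j) *
            (a * ((inner ℝ (d i) (z + t • d j) : ℝ) : ℂ))
          + polyAt d a P (z + t • d j) * (a * ((inner ℝ (d i) (d j) : ℝ) : ℂ)) := by
      rw [Derivation.leibniz, dirDeriv_X, gram_symm, gram]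
      simp only [polyAt, map_add, smul_eq_mul, map_mul, eval_X, eval_C]
      ring
    rw [e]
    refine h2.congr_of_eventuallyEq (Filter.Eventually.of_forall fun t => ?_)
    simp only [polyAt, map_mul, eval_X, Pi.mul_apply]

/-- Differentiating `P · exp(πiσ‖·‖²)` along `d j` replaces `P` by `P Xⱼ + a Dⱼ P`, where
`a = 2πiσ` is also the scale of the coordinates. -/
theorem hasDerivAt_polyGauss (d : J → E) {a σ : ℂ} (ha : a = 2 * Real.pi * Complex.I * σ) (j : J)
    (P : MvPolynomial J ℂ) (z : E) (t : ℝ) :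
    HasDerivAt (fun t : ℝ => polyGauss d a σ P (z + t • d j))
      (polyGauss d a σ (P * X j + a • dirDeriv (gram d) j P) (z + t • d j)) t := by
  refine ((hasDerivAt_polyAt d a j P z t).mul (hasDerivAt_gaussian σ z (d j) t)).congr_deriv ?_
  simp only [polyGauss, polyAt, map_add, map_mul, eval_X, smul_eq_C_mul, eval_C, ← ha]
  ring

theorem hasDerivAt_tsum_polyGauss (β : Module.Basis ι ℝ E) (d : J → E) {a σ : ℂ}
    (ha : a = 2 * Real.pi * Complex.I * σ) (hσ : 0 < σ.im) (j : J) (P : MvPolynomial J ℂ) (z : E) :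
    HasDerivAt (fun t : ℝ => ∑' m : ι → ℤ, polyGauss d a σ P (z + t • d j + latticePoint β m))
      (∑' m : ι → ℤ,
        polyGauss d a σ (P * X j + a • dirDeriv (gram d) j P) (z + latticePoint β m)) 0 := by
  obtain ⟨u, hu, h⟩ := exists_summable_bound_polyGauss β d a hσ
    (P * X j + a • dirDeriv (gram d) j P) (‖z‖ + ‖d j‖)
  have hd : ∀ (m : ι → ℤ) (t : ℝ), HasDerivAt
      (fun t : ℝ => polyGauss d a σ P (z + t • d j + latticePoint β m))
      (polyGauss d a σ (P * X j + a • dirDeriv (gram d) j P)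
        (z + t • d j + latticePoint β m)) t := by
    intro m t
    have := hasDerivAt_polyGauss d ha j P (z + latticePoint β m) t
    simpa only [add_right_comm] using this
  have key := hasDerivAt_tsum_of_isPreconnected (t := Metric.ball (0 : ℝ) 1) (y₀ := 0) (y := 0)
    hu Metric.isOpen_ball (convex_ball _ _).isPreconnected (fun m t _ => hd m t)
    (fun m t ht => h m _ ?_) (by simp) ?_ (by simp)
  · simpa using key
  · refine (norm_add_le _ _).trans (add_le_add le_rfl ?_)
    rw [norm_smul]
    have : ‖t‖ ≤ 1 := by simpa using (Metric.mem_ball.mp ht).le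
    nlinarith [norm_nonneg (d j)]
  · simpa using summable_polyGauss β d a hσ P z

end HarmonicGaussian

/-! ### Theta inversion with harmonic coefficients -/

section HarmonicInversion

open MvPolynomial

variable {J : Type*} [Fintype J] {E : Type*} [NormedAddCommGroup E] [InnerProductSpace ℝ E]
  {ι : Type*} [Fintype ι]

/-- The differential operator with symbol `P` applied to both sides of the inversion formula `h₀`,
regarded as functions of `z`. On the Fourier side it produces the factor `P`; on the Gaussian side
it produces `exp((a/2)Δ) P` with `a = 2πiσ`. Multiplication of `P` by `Xⱼ` corresponds to one more
derivative along `d j`, so the proof is by induction on `P`. The truncation `N` is any bound beyond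
which the powers of the Laplacian kill `P`. -/
theorem tsum_heat_polyGauss {β β' : Module.Basis ι ℝ E} {σ τ c₀ : ℂ} (hσ : 0 < σ.im)
    (hτ : 0 < τ.im)
    (h₀ : ∀ z : E, ∑' m : ι → ℤ, gaussian σ (z + latticePoint β m)
      = c₀ * ∑' k : ι → ℤ, gaussian τ (latticePoint β' k) *
        Complex.exp (2 * Real.pi * Complex.I * ((inner ℝ (latticePoint β' k) z : ℝ) : ℂ)))
    (d : J → E) (P : MvPolynomial J ℂ) :
    ∃ N, (laplacian (gram d) ^ N) P = 0 ∧ ∀ z : E,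
      ∑' m : ι → ℤ, polyGauss d (2 * Real.pi * Complex.I * σ) σ
          (heat (gram d) (Real.pi * Complex.I * σ) N P) (z + latticePoint β m)
        = c₀ * ∑' k : ι → ℤ,
          polyGauss d (2 * Real.pi * Complex.I) τ P (latticePoint β' k) *
          Complex.exp (2 * Real.pi * Complex.I * ((inner ℝ (latticePoint β' k) z : ℝ) : ℂ)) := by
  set a : ℂ := 2 * Real.pi * Complex.I * σ with ha
  set c : ℂ := Real.pi * Complex.I * σ with hc
  induction P using MvPolynomial.induction_on with
  | C x =>
    refine ⟨1, ?_, fun z => ?_⟩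
    · rw [pow_one, laplacian_apply]
      exact Finset.sum_eq_zero fun j _ => by simp
    · simp only [heat, Finset.range_one, Finset.sum_singleton, polyGauss, polyAt]
      simp only [pow_zero, Nat.factorial_zero, Nat.cast_one, div_one, one_smul,
        Module.End.one_apply, eval_C, mul_assoc, tsum_mul_left]
      rw [h₀]
      simp only [mul_assoc]
      ring
  | add P P' h h' =>
    obtain ⟨N, hN, h⟩ := h
    obtain ⟨N', hN', h'⟩ := h'
    refine ⟨max N N', ?_, fun z => ?_⟩
    · rw [map_add, Module.End.pow_map_zero_of_le (le_max_left _ _) hN,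
        Module.End.pow_map_zero_of_le (le_max_right _ _) hN', add_zero]
    · have e1 : ∀ a' σ' (R R' : MvPolynomial J ℂ) v, polyGauss d a' σ' (R + R') v
          = polyGauss d a' σ' R v + polyGauss d a' σ' R' v := by
        intro a' σ' R R' v
        simp only [polyGauss, polyAt, map_add, add_mul]
      rw [heat_add, heat_eq_of_le hN (le_max_left _ _), heat_eq_of_le hN' (le_max_right _ _)]
      simp only [e1, add_mul]
      have s : ∀ R : MvPolynomial J ℂ, Summable fun k : ι → ℤ =>
          polyGauss d (2 * Real.pi * Complex.I) τ R (latticePoint β' k) *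
          Complex.exp (2 * Real.pi * Complex.I *
            ((inner ℝ (latticePoint β' k) z : ℝ) : ℂ)) := by
        intro R
        have := summable_polyGauss β' d (2 * Real.pi * Complex.I) hτ R 0
        simp only [zero_add] at this
        refine Summable.of_norm_bounded this.norm fun k => ?_
        rw [norm_mul, norm_cexp_two_pi_I, mul_one]
      rw [(summable_polyGauss β d a hσ _ z).tsum_add (summable_polyGauss β d a hσ _ z),
        (s P).tsum_add (s P'), h, h', mul_add]
  | mul_X P j h =>
    obtain ⟨N, hN, h⟩ := h
    have hN1 : (laplacian (gram d) ^ (N + 1)) P = 0 :=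
      Module.End.pow_map_zero_of_le N.le_succ hN
    refine ⟨N + 1, ?_, fun z => ?_⟩
    · rw [laplacian_pow_succ_mul_X (gram_symm d), hN, hN1]
      simp
    · have h1 := hasDerivAt_tsum_polyGauss β d ha hσ j (heat (gram d) c N P) z
      have h2 := (hasDerivAt_tsum_fourier β' d hτ j P z).const_mul c₀
      have h3 : heat (gram d) c N P * X j + a • dirDeriv (gram d) j (heat (gram d) c N P)
          = heat (gram d) c (N + 1) (P * X j) := by
        rw [heat_succ_mul_X (gram_symm d), heat_eq_of_le hN N.le_succ]
        congr 2
        rw [ha, hc]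
        ring
      rw [h3] at h1
      simp only [h] at h1
      exact h1.unique h2

/-- **Theta inversion with a harmonic coefficient.** For harmonic `P` the heat operator acts as the
identity, so the previous formula involves `P` on both sides. -/
theorem tsum_harmonic_gaussian {β β' : Module.Basis ι ℝ E} {τ c₀ : ℂ} (hτ : 0 < τ.im)
    (h₀ : ∀ z : E, ∑' m : ι → ℤ, gaussian (-1 / τ) (z + latticePoint β m)
      = c₀ * ∑' k : ι → ℤ, gaussian τ (latticePoint β' k) *
        Complex.exp (2 * Real.pi * Complex.I * ((inner ℝ (latticePoint β' k) z : ℝ) : ℂ)))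
    (d : J → E) {P : MvPolynomial J ℂ} {ν : ℕ} (hP : P.IsHomogeneous ν)
    (hlap : laplacian (gram d) P = 0) (z : E) :
    ∑' m : ι → ℤ, polyGauss d 1 (-1 / τ) P (z + latticePoint β m)
      = c₀ * (-τ) ^ ν * ∑' k : ι → ℤ, polyGauss d 1 τ P (latticePoint β' k) *
        Complex.exp (2 * Real.pi * Complex.I * ((inner ℝ (latticePoint β' k) z : ℝ) : ℂ)) := by
  have hτ0 : τ ≠ 0 := fun h => by simp [h] at hτ
  have hσ : 0 < (-1 / τ).im := im_neg_one_div_pos hτ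
  obtain ⟨N, hN, h⟩ := tsum_heat_polyGauss hσ hτ h₀ d P
  have hheat : heat (gram d) (Real.pi * Complex.I * (-1 / τ)) N P = P := by
    rw [← heat_eq_of_le hN (le_max_left N 1),
      heat_eq_of_le (N := 1) (by simpa using hlap) (le_max_right N 1)]
    simp [heat]
  have hhom : ∀ a σ v, polyGauss d a σ P v = a ^ ν * polyGauss d 1 σ P v := by
    intro a σ v
    simp only [polyGauss, polyAt, one_mul, eval_const_mul_of_isHomogeneous hP, mul_assoc]
  have h := h z
  rw [hheat] at h
  have hpi : (2 * Real.pi * Complex.I : ℂ) ≠ 0 := by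
    simp [Real.pi_ne_zero]
  have h2 : (2 * Real.pi * Complex.I * (-1 / τ) : ℂ) = 2 * Real.pi * Complex.I * (-τ)⁻¹ := by
    field_simp
  rw [tsum_congr fun m => hhom _ _ _, tsum_mul_left,
    tsum_congr fun k => (congrArg (· * _) (hhom (2 * Real.pi * Complex.I) τ _)).trans
      (mul_assoc _ _ _), tsum_mul_left, h2, mul_pow, mul_assoc, mul_left_comm c₀] at h
  have h3 := mul_left_cancel₀ (pow_ne_zero ν hpi) h
  rw [inv_pow, inv_mul_eq_iff_eq_mul₀ (pow_ne_zero ν (neg_ne_zero.mpr hτ0))] at h3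
  rw [h3]
  ring

end HarmonicInversion

/-! ### Euclidean model of a rational quadratic space -/

section Embedding

variable {V : Type*} [AddCommGroup V] [Module ℚ V]

theorem polar_self_eq (Q : QuadraticForm ℚ V) (x : V) : QuadraticMap.polar Q x x = 2 * Q x := by
  rw [QuadraticMap.polar_self]
  simp

/-- A positive definite rational quadratic space embeds into a Euclidean space, in such a way that
`B` becomes the scalar product. -/
theorem exists_euclidean_embedding [FiniteDimensional ℚ V] {Q : QuadraticForm ℚ V}
    (hQ : Q.PosDef) :
    ∃ φ : V →+ EuclideanSpace ℝ (Fin (Module.finrank ℚ V)),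
      ∀ x y, inner ℝ (φ x) (φ y) = ((QuadraticMap.polar Q x y : ℚ) : ℝ) := by
  classical
  obtain ⟨w, ⟨g⟩⟩ := Q.equivalent_weightedSumSquares
  have hg : ∀ x, Q x = ∑ i, w i * (g x i * g x i) := fun x => by
    rw [← g.map_app x, QuadraticMap.weightedSumSquares_apply]
    rfl
  have hw : ∀ i, 0 < w i := by
    intro i
    have h := hQ (g.symm (Pi.single i 1)) (fun h0 => by
      have := congrArg g h0
      rw [g.apply_symm_apply, map_zero] at this
      simpa using congrFun this i)
    rw [hg, g.apply_symm_apply] at h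
    simpa [Pi.single_apply] using h
  refine ⟨AddMonoidHom.mk' (fun x => WithLp.toLp 2 fun i => √(2 * w i) * (g x i : ℝ)) ?_, ?_⟩
  · intro x y
    ext i
    simp [mul_add]
  · intro x y
    simp only [AddMonoidHom.mk'_apply, PiLp.inner_apply, RCLike.inner_apply, conj_trivial]
    rw [QuadraticMap.polar, hg, hg, hg, ← Finset.sum_sub_distrib, ← Finset.sum_sub_distrib]
    push_cast
    refine Finset.sum_congr rfl fun i _ => ?_
    have h : √(2 * (w i : ℝ)) * √(2 * (w i : ℝ)) = 2 * w i :=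
      Real.mul_self_sqrt (by have : (0 : ℝ) < w i := by exact_mod_cast hw i
                             positivity)
    rw [map_add]
    simp only [Pi.add_apply]
    push_cast
    linear_combination (g x i : ℝ) * (g y i : ℝ) * h

theorem nondegenerate_polarBilin {Q : QuadraticForm ℚ V} (hQ : Q.PosDef) :
    LinearMap.BilinForm.Nondegenerate (QuadraticMap.polarBilin Q) := by
  have h : ∀ x, (∀ y, QuadraticMap.polar Q x y = 0) → x = 0 := by
    intro x hx
    by_contra hne
    have h1 := hQ x hne
    have h2 := hx x
    rw [polar_self_eq] at h2
    linarith
  refine ⟨fun x hx => h x hx, fun y hy => h y fun x => ?_⟩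
  rw [QuadraticMap.polar_comm]
  exact hy x

/-- The basis dual to `b` with respect to `B`. -/
def dualBasis {κ : Type*} [Finite κ] [DecidableEq κ] {Q : QuadraticForm ℚ V} (hQ : Q.PosDef)
    (b : Module.Basis κ ℚ V) : Module.Basis κ ℚ V :=
  LinearMap.BilinForm.dualBasis _ (nondegenerate_polarBilin hQ) b

theorem polar_dualBasis {κ : Type*} [Finite κ] [DecidableEq κ] {Q : QuadraticForm ℚ V}
    (hQ : Q.PosDef) (b : Module.Basis κ ℚ V) (i j : κ) :
    QuadraticMap.polar Q (dualBasis hQ b i) (b j) = if i = j then 1 else 0 := by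
  have := LinearMap.BilinForm.apply_dualBasis_left (nondegenerate_polarBilin hQ) b i j
  simp only [eq_comm (a := j)] at this
  exact this

theorem polar_sum_right {κ : Type*} (Q : QuadraticForm ℚ V) (s : Finset κ) (x : V) (c : κ → ℚ)
    (v : κ → V) :
    QuadraticMap.polar Q x (∑ i ∈ s, c i • v i) = ∑ i ∈ s, c i * QuadraticMap.polar Q x (v i) := by
  refine (map_sum (QuadraticMap.polarBilin Q x) (fun i => c i • v i) s).trans ?_
  exact Finset.sum_congr rfl fun i _ => QuadraticMap.polar_smul_right Q (c i) x (v i)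

theorem repr_eq_polar_dualBasis {κ : Type*} [Fintype κ] [DecidableEq κ] {Q : QuadraticForm ℚ V}
    (hQ : Q.PosDef) (b : Module.Basis κ ℚ V) (x : V) (i : κ) :
    b.repr x i = QuadraticMap.polar Q (dualBasis hQ b i) x := by
  conv_rhs => rw [← b.sum_repr x]
  rw [polar_sum_right]
  simp [polar_dualBasis]

/-- The Gram matrix of the dual basis is the inverse of the Gram matrix. -/
theorem inv_gram_eq {κ : Type*} [Fintype κ] [DecidableEq κ] {Q : QuadraticForm ℚ V}
    (hQ : Q.PosDef) (b : Module.Basis κ ℚ V) (j k : κ) :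
    (Matrix.of fun i l => QuadraticMap.polar Q (b i) (b l))⁻¹ j k
      = QuadraticMap.polar Q (dualBasis hQ b j) (dualBasis hQ b k) := by
  have h : (Matrix.of fun i l => QuadraticMap.polar Q (b i) (b l))
      * (Matrix.of fun i l => QuadraticMap.polar Q (dualBasis hQ b i) (dualBasis hQ b l)) = 1 := by
    ext i l
    rw [Matrix.mul_apply, Matrix.one_apply]
    simp only [Matrix.of_apply]
    have h1 : dualBasis hQ b l = ∑ k, QuadraticMap.polar Q (dualBasis hQ b k) (dualBasis hQ b l) •
        b k := by
      conv_lhs => rw [← b.sum_repr (dualBasis hQ b l)]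
      simp only [repr_eq_polar_dualBasis hQ]
    have h2 : QuadraticMap.polar Q (b i) (dualBasis hQ b l) = if i = l then 1 else 0 := by
      rw [QuadraticMap.polar_comm, polar_dualBasis]
      simp [eq_comm]
    rw [← h2]
    conv_rhs => rw [h1]
    rw [polar_sum_right]
    exact Finset.sum_congr rfl fun k _ => mul_comm _ _
  rw [Matrix.inv_eq_right_inv h]
  rfl

variable {E : Type*} [NormedAddCommGroup E] [InnerProductSpace ℝ E]

/-- Linear independence over `ℝ` of a rational basis, detected by its dual basis. -/
theorem linearIndependent_of_biorthogonal {κ : Type*} [DecidableEq κ] {u v : κ → E}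
    (h : ∀ i j, inner ℝ (u i) (v j) = if i = j then (1 : ℝ) else 0) : LinearIndependent ℝ v := by
  rw [linearIndependent_iff']
  intro s c hc i hi
  have h1 := congrArg (fun x => inner ℝ (u i) x) hc
  simpa [inner_sum, inner_smul_right, h, hi] using h1

/-- The real basis obtained from a rational basis by an isometric embedding of full rank. -/
theorem exists_real_basis {κ : Type*} [Fintype κ] [DecidableEq κ] [FiniteDimensional ℝ E]
    {Q : QuadraticForm ℚ V} (hQ : Q.PosDef)
    {φ : V →+ E} (hφ : ∀ x y, inner ℝ (φ x) (φ y) = ((QuadraticMap.polar Q x y : ℚ) : ℝ))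
    (hE : Module.finrank ℝ E = Fintype.card κ) (b : Module.Basis κ ℚ V) :
    ∃ β β' : Module.Basis κ ℝ E, (∀ i, β i = φ (b i)) ∧ (∀ i, β' i = φ (dualBasis hQ b i)) ∧
      ∀ i j, inner ℝ (β' i) (β j) = if i = j then (1 : ℝ) else 0 := by
  have h1 : ∀ i j, inner ℝ (φ (dualBasis hQ b i)) (φ (b j)) = if i = j then (1 : ℝ) else 0 := by
    intro i j
    rw [hφ, polar_dualBasis]
    split_ifs <;> simp
  have h2 : ∀ i j, inner ℝ (φ (b i)) (φ (dualBasis hQ b j)) = if i = j then (1 : ℝ) else 0 := by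
    intro i j
    rw [real_inner_comm, h1]
    simp [eq_comm]
  have l1 := linearIndependent_of_biorthogonal h1
  have l2 := linearIndependent_of_biorthogonal h2
  refine ⟨Module.Basis.mk l1 (l1.span_eq_top_of_card_eq_finrank' hE.symm).ge,
    Module.Basis.mk l2 (l2.span_eq_top_of_card_eq_finrank' hE.symm).ge, fun i => ?_, fun i => ?_,
    fun i j => ?_⟩
  · simp
  · simp
  · simpa using h1 i j

/-- In the Euclidean model the coordinates with respect to `b` are the scalar products with the dual
basis `d`, whose Gram matrix is the inverse Gram matrix of `b`. Hence a spherical polynomial is a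
polynomial in these scalar products that is annihilated by `laplacian (gram d)`. -/
theorem exists_polyAt_of_isSpherical [FiniteDimensional ℚ V] {Q : QuadraticForm ℚ V}
    (hQ : Q.PosDef) {φ : V →+ E}
    (hφ : ∀ x y, inner ℝ (φ x) (φ y) = ((QuadraticMap.polar Q x y : ℚ) : ℝ)) {ν : ℕ} {p : V → ℂ}
    (hp : IsSpherical Q ν p) :
    ∃ (d : Fin (Module.finrank ℚ V) → E) (P : MvPolynomial (Fin (Module.finrank ℚ V)) ℂ),
      P.IsHomogeneous ν ∧ laplacian (gram d) P = 0 ∧ ∀ x, p x = polyAt d 1 P (φ x) := by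
  obtain ⟨b, P, hhom, heval, hlap⟩ := hp
  refine ⟨fun j => φ (dualBasis hQ b j), P, hhom, ?_, fun x => ?_⟩
  · rw [laplacian_apply, ← hlap]
    refine Finset.sum_congr rfl fun j _ => ?_
    rw [dirDeriv_apply]
    refine Finset.sum_congr rfl fun k _ => ?_
    rw [inv_gram_eq hQ, gram, hφ, MvPolynomial.smul_eq_C_mul, pderiv_comm]
    norm_cast
  · rw [polyAt]
    conv_lhs => rw [← b.sum_repr x]
    rw [heval]
    simp only [hφ, one_mul, repr_eq_polar_dualBasis hQ]
    norm_cast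

/-- `L` and `L^♯` become the lattices spanned by a pair of dual real bases. -/
theorem exists_lattice_bases {L : Submodule ℤ V} [FiniteDimensional ℚ V] {Q : QuadraticForm ℚ V}
    (hL : Submodule.IsLattice ℚ L) (hQ : Q.PosDef) [FiniteDimensional ℝ E] {φ : V →+ E}
    (hφ : ∀ x y, inner ℝ (φ x) (φ y) = ((QuadraticMap.polar Q x y : ℚ) : ℝ))
    (hE : Module.finrank ℝ E = Module.finrank ℚ V) :
    ∃ (β β' : Module.Basis (Fin (Module.finrank ℚ V)) ℝ E)
      (eL : (Fin (Module.finrank ℚ V) → ℤ) ≃ L)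
      (eD : (Fin (Module.finrank ℚ V) → ℤ) ≃ dualLattice L Q),
      (∀ i j, inner ℝ (β' i) (β j) = if i = j then (1 : ℝ) else 0) ∧
      (∀ m, φ (eL m) = latticePoint β m) ∧ (∀ k, φ (eD k) = latticePoint β' k) := by
  classical
  have hfree : Module.Free ℤ L := Submodule.IsLattice.free ℚ L
  have hfin : Module.Finite ℤ L := inferInstance
  have c₀ := Module.Free.chooseBasis ℤ L
  have hcard : Fintype.card (Module.Free.ChooseBasisIndex ℤ L)
      = Fintype.card (Fin (Module.finrank ℚ V)) := by
    rw [← Module.finrank_eq_card_basis (c₀.extendOfIsLattice ℚ), Fintype.card_fin]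
  let c := c₀.reindex (Fintype.equivOfCardEq hcard)
  let b := c.extendOfIsLattice ℚ
  have hb : ∀ i, b i = (c i : V) := fun i => Module.Basis.extendOfIsLattice_apply ℚ c i
  have hspan : L = Submodule.span ℤ (Set.range b) := by
    have h1 := congrArg (Submodule.map L.subtype) c.span_eq
    rw [Submodule.map_span, Submodule.map_top, Submodule.range_subtype, ← Set.range_comp] at h1
    rw [← h1]
    congr 2
    ext i
    exact (hb i).symm
  have hdual : dualLattice L Q = Submodule.span ℤ (Set.range (dualBasis hQ b)) := by
    conv_lhs => rw [hspan]
    exact LinearMap.BilinForm.dualSubmodule_span_of_basis _ (nondegenerate_polarBilin hQ) b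
  obtain ⟨β, β', hβ, hβ', hδ⟩ := exists_real_basis hQ hφ
    (hE.trans (Fintype.card_fin _).symm) b
  have hsum : ∀ (v : Fin (Module.finrank ℚ V) → V) (m : Fin (Module.finrank ℚ V) → ℤ),
      φ (∑ i, m i • v i) = ∑ i, (m i : ℝ) • φ (v i) := by
    intro v m
    rw [map_sum]
    refine Finset.sum_congr rfl fun i _ => ?_
    rw [map_zsmul, Int.cast_smul_eq_zsmul]
  let c' := (dualBasis hQ b).restrictScalars ℤ
  refine ⟨β, β', c.equivFun.symm.toEquiv,
    c'.equivFun.symm.toEquiv.trans (LinearEquiv.ofEq _ _ hdual.symm).toEquiv, hδ,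
    fun m => ?_, fun k => ?_⟩
  · have h1 : ((c.equivFun.symm.toEquiv m : L) : V) = ∑ i, m i • b i := by
      change ((c.equivFun.symm m : L) : V) = _
      rw [Module.Basis.equivFun_symm_apply, Submodule.coe_sum]
      simp [hb]
    rw [h1, hsum, latticePoint]
    simp [hβ]
  · have h1 : ((c'.equivFun.symm k : _) : V) = ∑ i, k i • dualBasis hQ b i := by
      rw [Module.Basis.equivFun_symm_apply, Submodule.coe_sum]
      refine Finset.sum_congr rfl fun i _ => ?_
      rw [Submodule.coe_smul]
      exact congrArg _ (Module.Basis.restrictScalars_apply ℤ _ i)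
    change φ ((c'.equivFun.symm k : _) : V) = _
    rw [h1, hsum, latticePoint]
    simp [hβ']

end Embedding

/-! ### Theta series of a lift -/

section Character

theorem e_add (s t : QModZ) : e (s + t) = e s * e t := by
  induction s using QuotientAddGroup.induction_on with | _ s =>
  induction t using QuotientAddGroup.induction_on with | _ t =>
  change e ((s + t : ℚ) : QModZ) = e (s : QModZ) * e (t : QModZ)
  rw [e_coe, e_coe, e_coe, ← Complex.exp_add]
  congr 1
  push_cast
  ring

theorem e_zero : e 0 = 1 := by
  change e ((0 : ℚ) : QModZ) = 1
  rw [e_coe]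
  simp

theorem e_eq_one_iff {t : QModZ} : e t = 1 ↔ t = 0 := by
  refine ⟨fun h => ?_, fun h => by rw [h, e_zero]⟩
  induction t using QuotientAddGroup.induction_on with | _ t =>
  change e (t : QModZ) = 1 at h
  rw [e_coe, Complex.exp_eq_one_iff] at h
  obtain ⟨n, hn⟩ := h
  have hpi : (2 * Real.pi * Complex.I : ℂ) ≠ 0 := by simp [Real.pi_ne_zero]
  rw [mul_comm] at hn
  have h2 : (t : ℂ) = n := mul_right_cancel₀ hpi hn
  have h3 : t = n := by exact_mod_cast h2
  change (t : QModZ) = 0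
  rw [h3]
  exact (AddCircle.coe_eq_zero_iff 1).mpr ⟨n, by simp⟩

end Character

section QuadraticModule

variable {M : Type*} [AddCommGroup M] {𝒬 : M → QModZ}

theorem IsQuadraticModule.polar_zero_left (h : IsQuadraticModule 𝒬) (y : M) :
    QuadraticMap.polar 𝒬 0 y = 0 := by
  simpa using h.polar_add_left 0 0 y

theorem IsQuadraticModule.polar_neg_left (h : IsQuadraticModule 𝒬) (x y : M) :
    QuadraticMap.polar 𝒬 (-x) y = -QuadraticMap.polar 𝒬 x y := by
  have := h.polar_add_left (-x) x y
  rw [neg_add_cancel, h.polar_zero_left] at this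
  exact eq_neg_of_add_eq_zero_left this.symm

theorem IsQuadraticModule.polar_add_right (h : IsQuadraticModule 𝒬) (x y z : M) :
    QuadraticMap.polar 𝒬 x (y + z) = QuadraticMap.polar 𝒬 x y + QuadraticMap.polar 𝒬 x z := by
  rw [QuadraticMap.polar_comm, h.polar_add_left, QuadraticMap.polar_comm,
    QuadraticMap.polar_comm 𝒬 z]

theorem IsQuadraticModule.polar_neg_right (h : IsQuadraticModule 𝒬) (x y : M) :
    QuadraticMap.polar 𝒬 x (-y) = -QuadraticMap.polar 𝒬 x y := by
  rw [QuadraticMap.polar_comm, h.polar_neg_left, QuadraticMap.polar_comm]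

theorem IsQuadraticModule.map_zero (h : IsQuadraticModule 𝒬) : 𝒬 0 = 0 := by
  have := h.polar_zero_left 0
  simpa [QuadraticMap.polar] using this

theorem map_add_eq (𝒬 : M → QModZ) (x y : M) :
    𝒬 (x + y) = 𝒬 x + 𝒬 y + QuadraticMap.polar 𝒬 x y := by
  rw [QuadraticMap.polar]
  abel

end QuadraticModule

section Theta

variable {V : Type*} [AddCommGroup V] [Module ℚ V] {M : Type*} [AddCommGroup M]
  {𝒬 : M → QModZ} {L : Submodule ℤ V} {Q : QuadraticForm ℚ V}

/-- The projection `L^♯ → L^♯ / L ≃ M`. -/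
def Lift.proj (ℓ : Lift 𝒬 L Q) : dualLattice L Q →+ M :=
  ℓ.π.toAddMonoidHom.comp (Submodule.mkQ (L.submoduleOf (dualLattice L Q))).toAddMonoidHom

theorem Lift.proj_apply (ℓ : Lift 𝒬 L Q) (x : dualLattice L Q) :
    ℓ.proj x = ℓ.π (Submodule.Quotient.mk x) := rfl

theorem Lift.proj_surjective (ℓ : Lift 𝒬 L Q) : Function.Surjective ℓ.proj :=
  ℓ.π.surjective.comp (Submodule.mkQ_surjective _)

theorem Lift.map_proj (ℓ : Lift 𝒬 L Q) (x : dualLattice L Q) :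
    𝒬 (ℓ.proj x) = ((Q (x : V) : ℚ) : QModZ) := ℓ.map_π x

theorem Lift.polar_proj (ℓ : Lift 𝒬 L Q) (x y : dualLattice L Q) :
    QuadraticMap.polar 𝒬 (ℓ.proj x) (ℓ.proj y)
      = ((QuadraticMap.polar Q (x : V) (y : V) : ℚ) : QModZ) := by
  rw [QuadraticMap.polar, ← map_add, ℓ.map_proj, ℓ.map_proj, ℓ.map_proj, QuadraticMap.polar]
  rfl

theorem Lift.proj_eq_zero_iff (ℓ : Lift 𝒬 L Q) (x : dualLattice L Q) :
    ℓ.proj x = 0 ↔ (x : V) ∈ L := by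
  rw [ℓ.proj_apply, ℓ.π.map_eq_zero_iff, Submodule.Quotient.mk_eq_zero]
  rfl

theorem Lift.le_dualLattice (ℓ : Lift 𝒬 L Q) : L ≤ dualLattice L Q := by
  intro y hy
  rw [mem_dualLattice]
  intro x hx
  obtain ⟨a, ha⟩ := ℓ.integral _ (L.add_mem hx hy)
  obtain ⟨b, hb⟩ := ℓ.integral _ hx
  obtain ⟨c, hc⟩ := ℓ.integral _ hy
  exact ⟨a - b - c, by rw [QuadraticMap.polar, ha, hb, hc]; push_cast; ring⟩

/-- A choice of representatives of the cosets splits `L^♯` as a union of translates of `L`. -/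
theorem Lift.exists_coset_equiv (ℓ : Lift 𝒬 L Q) :
    ∃ (y : M → dualLattice L Q) (g : M × L ≃ dualLattice L Q), (∀ m, ℓ.proj (y m) = m) ∧
      (∀ m l, ((g (m, l) : dualLattice L Q) : V) = y m + l) ∧ ∀ m l, ℓ.proj (g (m, l)) = m := by
  choose y hy using ℓ.proj_surjective
  let g : M × L → dualLattice L Q := fun a => y a.1 + ⟨a.2, ℓ.le_dualLattice a.2.2⟩
  have hg : ∀ m l, ℓ.proj (g (m, l)) = m := by
    intro m l
    simp only [g, map_add, hy]
    rw [(ℓ.proj_eq_zero_iff _).mpr l.2, add_zero]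
  have hbij : Function.Bijective g := by
    constructor
    · rintro ⟨m, l⟩ ⟨m', l'⟩ h
      have h1 : m = m' := by rw [← hg m l, h, hg]
      subst h1
      have h2 := congrArg (Subtype.val) (add_left_cancel h)
      exact Prod.ext rfl (Subtype.ext h2)
    · intro x
      refine ⟨(ℓ.proj x, ⟨(x - y (ℓ.proj x) : dualLattice L Q), ?_⟩), ?_⟩
      · rw [← ℓ.proj_eq_zero_iff, map_sub, hy, sub_self]
      · exact Subtype.ext (by simp [g])
  exact ⟨y, Equiv.ofBijective g hbij, hy, fun m l => rfl, hg⟩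

variable {E : Type*} [NormedAddCommGroup E] [InnerProductSpace ℝ E] {J : Type*}

theorem gaussian_embedding {φ : V →+ E}
    (hφ : ∀ x y, inner ℝ (φ x) (φ y) = ((QuadraticMap.polar Q x y : ℚ) : ℝ)) (τ : ℂ) (x : V) :
    gaussian τ (φ x) = Complex.exp (2 * Real.pi * Complex.I * ((Q x : ℚ) : ℂ) * τ) := by
  rw [gaussian, ← real_inner_self_eq_norm_sq, hφ, polar_self_eq]
  congr 1
  push_cast
  ring

theorem thetaTerm_eq_polyGauss (ℓ : Lift 𝒬 L Q) {φ : V →+ E}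
    (hφ : ∀ x y, inner ℝ (φ x) (φ y) = ((QuadraticMap.polar Q x y : ℚ) : ℝ)) {p : V → ℂ}
    {d : J → E} {P : MvPolynomial J ℂ} (hp : ∀ x, p x = polyAt d 1 P (φ x)) (f : M → ℂ) (τ : ℍ)
    (x : dualLattice L Q) :
    thetaTerm ℓ p f τ x = f (ℓ.proj x) * polyGauss d 1 τ P (φ x) := by
  rw [thetaTerm, polyGauss, ← hp, gaussian_embedding hφ, ℓ.proj_apply, mul_assoc]

theorem summable_polyGauss_dual {κ : Type*} [Fintype κ] {φ : V →+ E} {β' : Module.Basis κ ℝ E}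
    {eD : (κ → ℤ) ≃ dualLattice L Q} (hD : ∀ k, φ (eD k) = latticePoint β' k) (d : J → E)
    (P : MvPolynomial J ℂ) {τ : ℂ} (hτ : 0 < τ.im) :
    Summable fun w : dualLattice L Q => polyGauss d 1 τ P (φ w) := by
  rw [← eD.summable_iff]
  have h1 := summable_polyGauss β' d 1 hτ P 0
  refine h1.congr fun k => ?_
  rw [zero_add, ← hD, Function.comp_apply]

theorem summable_thetaTerm [FiniteDimensional ℚ V] [Finite M] (ℓ : Lift 𝒬 L Q) {ν : ℕ}
    {p : V → ℂ} (hp : IsSpherical Q ν p) (f : M → ℂ) (τ : ℍ) : Summable (thetaTerm ℓ p f τ) := by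
  obtain ⟨φ, hφ⟩ := exists_euclidean_embedding ℓ.posDef
  obtain ⟨d, P, -, -, hpP⟩ := exists_polyAt_of_isSpherical ℓ.posDef hφ hp
  obtain ⟨β, β', eL, eD, -, -, hD⟩ := exists_lattice_bases ℓ.isLattice ℓ.posDef hφ (by simp)
  have h2 := summable_polyGauss_dual hD d P τ.im_pos
  obtain ⟨C, hC⟩ := (Set.finite_range fun m => ‖f m‖).bddAbove
  refine Summable.of_norm_bounded (h2.norm.mul_left C) fun x => ?_
  rw [thetaTerm_eq_polyGauss ℓ hφ hpP, norm_mul]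
  gcongr
  exact hC ⟨_, rfl⟩

/-- Multiplication by `e(𝒬)`. -/
def phaseMul (𝒬 : M → QModZ) : Module.End ℂ (M → ℂ) where
  toFun f x := e (𝒬 x) * f x
  map_add' f g := by
    ext x
    simp [mul_add]
  map_smul' c f := by
    ext x
    simp [mul_left_comm]

theorem theta_slash_T (ℓ : Lift 𝒬 L Q) (p : V → ℂ) (f : M → ℂ) (k : ℤ) :
    theta ℓ p f ∣[k] ModularGroup.T = theta ℓ p (phaseMul 𝒬 f) := by
  ext τ
  have hden : UpperHalfPlane.denom (ModularGroup.T : GL (Fin 2) ℝ) τ = 1 := by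
    rw [ModularGroup.denom_apply]
    simp [ModularGroup.T]
  rw [ModularForm.SL_slash_apply, hden, one_zpow, mul_one, theta, theta]
  refine tsum_congr fun x => ?_
  rw [thetaTerm, thetaTerm, UpperHalfPlane.modular_T_smul, ← ℓ.proj_apply]
  change _ = e (𝒬 (ℓ.proj x)) * f (ℓ.proj x) * _ * _
  rw [ℓ.map_proj, e_coe, UpperHalfPlane.coe_vadd, mul_add, Complex.exp_add]
  push_cast
  rw [mul_one]
  ring

theorem isLinearMap_theta [FiniteDimensional ℚ V] [Finite M] (ℓ : Lift 𝒬 L Q) {ν : ℕ}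
    {p : V → ℂ} (hp : IsSpherical Q ν p) : IsLinearMap ℂ (theta ℓ p) where
  map_add f g := by
    ext τ
    rw [Pi.add_apply, theta, theta, theta,
      ← (summable_thetaTerm ℓ hp f τ).tsum_add (summable_thetaTerm ℓ hp g τ)]
    refine tsum_congr fun x => ?_
    simp only [thetaTerm, Pi.add_apply, add_mul]
  map_smul c f := by
    ext τ
    rw [Pi.smul_apply, theta, theta, smul_eq_mul, ← tsum_mul_left]
    refine tsum_congr fun x => ?_
    simp only [thetaTerm, Pi.smul_apply, smul_eq_mul, mul_assoc]

theorem isSpherical_one [FiniteDimensional ℚ V] (Q : QuadraticForm ℚ V) :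
    IsSpherical Q 0 fun _ => 1 :=
  ⟨Module.finBasis ℚ V, 1, MvPolynomial.isHomogeneous_one _ _, fun ξ => by simp, by simp⟩

/-- A weight that is nonnegative and somewhere positive has a nonzero theta series. -/
theorem theta_one_ne_zero [FiniteDimensional ℚ V] [Finite M] (ℓ : Lift 𝒬 L Q) {f : M → ℝ}
    (hf : ∀ m, 0 ≤ f m) {a : M} (ha : 0 < f a) :
    theta ℓ (fun _ => 1) (fun m => (f m : ℂ)) ≠ 0 := by
  intro h0
  let F : dualLattice L Q → ℝ := fun x =>
    f (ℓ.proj x) * Real.exp (-(2 * Real.pi * ((Q (x : V) : ℚ) : ℝ)))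
  have hF : ∀ x, thetaTerm ℓ (fun _ => 1) (fun m => (f m : ℂ)) UpperHalfPlane.I x = (F x : ℂ) := by
    intro x
    rw [thetaTerm, ← ℓ.proj_apply, UpperHalfPlane.coe_I]
    simp only [F, mul_one]
    push_cast
    congr 2
    linear_combination (2 * (Real.pi : ℂ) * ((Q (x : V) : ℚ) : ℂ)) * Complex.I_mul_I
  have hs := summable_thetaTerm ℓ (isSpherical_one Q) (fun m => (f m : ℂ)) UpperHalfPlane.I
  have h1 := congrFun h0 UpperHalfPlane.I
  rw [theta, tsum_congr hF, ← Complex.ofReal_tsum] at h1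
  have hsF : Summable F := Complex.summable_ofReal.mp (hs.congr hF)
  obtain ⟨x, hx⟩ := ℓ.proj_surjective a
  have h2 := hsF.tsum_pos (fun x => mul_nonneg (hf _) (Real.exp_pos _).le) x
    (mul_pos (by rw [hx]; exact ha) (Real.exp_pos _))
  exact h2.ne' (Complex.ofReal_eq_zero.mp h1)

variable [Fintype M]

/-- The finite Fourier transform `f ↦ ∑ y, e(-ℬ(·, y)) f(y)`. -/
def finiteFourier (𝒬 : M → QModZ) : Module.End ℂ (M → ℂ) where
  toFun f x := ∑ y, e (-QuadraticMap.polar 𝒬 x y) * f y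
  map_add' f g := by
    ext x
    simp [mul_add, Finset.sum_add_distrib]
  map_smul' c f := by
    ext x
    simp only [Pi.smul_apply, smul_eq_mul, RingHom.id_apply, Finset.mul_sum]
    exact Finset.sum_congr rfl fun y _ => by ring

theorem finiteFourier_apply (f : M → ℂ) (x : M) :
    finiteFourier 𝒬 f x = ∑ y, e (-QuadraticMap.polar 𝒬 x y) * f y := rfl

/-- Collects the automorphy factor; the sign `(-1)^ν` comes from the parity of the polynomial. -/
theorem inversion_factor_eq (D t X : ℂ) (r ν : ℕ) :
    D * (-Complex.I * t) ^ r * (-t) ^ ν * ((-1) ^ ν * X)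
      = D * (-Complex.I) ^ r * t ^ (r + ν) * X := by
  have h : ((-1 : ℂ) ^ ν) * (-1) ^ ν = 1 := by
    rw [← mul_pow]
    simp
  rw [mul_pow, neg_pow t ν, pow_add]
  linear_combination (D * (-Complex.I) ^ r * t ^ r * t ^ ν * X) * h

/-- Inversion formula for the theta series. The constant depends neither on the polynomial nor on
its degree. -/
theorem exists_theta_inversion [FiniteDimensional ℚ V] (h𝒬 : IsQuadraticModule 𝒬)
    (ℓ : Lift 𝒬 L Q) {r : ℕ} (hV : Module.finrank ℚ V = 2 * r) :
    ∃ c : ℂ, c ≠ 0 ∧ ∀ (ν : ℕ) (p : V → ℂ), IsSpherical Q ν p → ∀ (f : M → ℂ) (τ σ : ℍ),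
      (σ : ℂ) = -1 / τ →
      theta ℓ p f σ = c * (τ : ℂ) ^ (r + ν) * theta ℓ p (finiteFourier 𝒬 f) τ := by
  classical
  obtain ⟨φ, hφ⟩ := exists_euclidean_embedding ℓ.posDef
  obtain ⟨β, β', eL, eD, hδ, hL, hD⟩ := exists_lattice_bases ℓ.isLattice ℓ.posDef hφ (by simp)
  obtain ⟨D, hD0, hpoisson⟩ := exists_gaussian_poisson β β' hδ (r := r) (by simpa using hV)
  refine ⟨D * (-Complex.I) ^ r, ?_, fun ν p hp f τ σ hστ => ?_⟩
  · exact mul_ne_zero (by exact_mod_cast hD0.ne')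
      (pow_ne_zero _ (neg_ne_zero.mpr Complex.I_ne_zero))
  obtain ⟨d, P, hhom, hlap, hpP⟩ := exists_polyAt_of_isSpherical ℓ.posDef hφ hp
  obtain ⟨y, g, hy, hg, hgp⟩ := ℓ.exists_coset_equiv
  have hterm := fun f τ => thetaTerm_eq_polyGauss ℓ hφ hpP f τ
  have hinv := fun z => tsum_harmonic_gaussian τ.im_pos (hpoisson τ τ.im_pos) d hhom hlap z
  let G : M → dualLattice L Q → ℂ := fun m w => polyGauss d 1 τ P (φ w) *
    e (QuadraticMap.polar 𝒬 (ℓ.proj w) m)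
  have hGs : ∀ m, Summable (G m) := by
    intro m
    have h2 := summable_polyGauss_dual hD d P τ.im_pos
    refine Summable.of_norm_bounded h2.norm fun w => ?_
    obtain ⟨x, hx⟩ := ℓ.proj_surjective m
    have h3 := norm_cexp_two_pi_I ((QuadraticMap.polar Q (w : V) (x : V) : ℚ) : ℝ)
    rw [norm_mul, ← hx, ℓ.polar_proj, e_coe]
    push_cast at h3
    rw [h3, mul_one]
  -- Poisson summation over each coset of `L` in `L^♯`
  have hcoset : ∀ m, ∑' l : L, polyGauss d 1 σ P (φ (g (m, l)))
      = D * (-Complex.I * τ) ^ r * (-τ) ^ ν * ∑' w, G m w := by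
    intro m
    have h1 := hinv (φ (y m))
    rw [← hστ] at h1
    have h2 : ∀ k, polyGauss d 1 σ P (φ (g (m, eL k)))
        = polyGauss d 1 σ P (φ (y m) + latticePoint β k) := fun k => by
      rw [hg, map_add φ, hL]
    have h3 : ∀ k, polyGauss d 1 τ P (latticePoint β' k) * Complex.exp (2 * Real.pi * Complex.I *
        ((inner ℝ (latticePoint β' k) (φ (y m)) : ℝ) : ℂ)) = G m (eD k) := fun k => by
      have h4 : QuadraticMap.polar 𝒬 (ℓ.proj (eD k)) m
          = ((QuadraticMap.polar Q (eD k : V) (y m : V) : ℚ) : QModZ) := by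
        rw [← ℓ.polar_proj, hy]
      simp only [G]
      rw [h4, e_coe, ← hD, hφ, Complex.ofReal_ratCast]
    rw [← eL.tsum_eq, ← eD.tsum_eq, tsum_congr h2, h1, tsum_congr h3]
  -- the sign of the character is adjusted by `w ↦ -w`, at the cost of the parity of `P`
  have hneg : ∀ w, ∑ m, f m * G m (-w)
      = (-1) ^ ν * thetaTerm ℓ p (finiteFourier 𝒬 f) τ w := by
    intro w
    rw [hterm, finiteFourier_apply, Finset.sum_mul, Finset.mul_sum]
    refine Finset.sum_congr rfl fun m _ => ?_
    have h1 : polyGauss d 1 τ P (φ ((-w : dualLattice L Q) : V))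
        = (-1) ^ ν * polyGauss d 1 τ P (φ w) := by
      rw [Submodule.coe_neg, map_neg]
      simp only [polyGauss, polyAt, gaussian, norm_neg, inner_neg_right, one_mul]
      rw [← mul_assoc, ← eval_const_mul_of_isHomogeneous hhom]
      simp
    simp only [G]
    rw [h1, map_neg, h𝒬.polar_neg_left]
    ring
  have hflip : ∑' w, ∑ m, f m * G m (-w) = ∑' w, ∑ m, f m * G m w :=
    (Equiv.neg (dualLattice L Q)).tsum_eq fun w => ∑ m, f m * G m w
  have hs : Summable fun a : M × L => thetaTerm ℓ p f σ (g a) :=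
    g.summable_iff.mpr (summable_thetaTerm ℓ hp f σ)
  calc theta ℓ p f σ = ∑' a : M × L, thetaTerm ℓ p f σ (g a) := (g.tsum_eq _).symm
    _ = ∑ m, ∑' l : L, thetaTerm ℓ p f σ (g (m, l)) := by
      rw [hs.tsum_prod, tsum_fintype]
    _ = ∑ m, f m * (D * (-Complex.I * τ) ^ r * (-τ) ^ ν * ∑' w, G m w) := by
      refine Finset.sum_congr rfl fun m _ => ?_
      rw [← hcoset, ← tsum_mul_left]
      refine tsum_congr fun l => ?_
      rw [hterm, hgp]
    _ = D * (-Complex.I * τ) ^ r * (-τ) ^ ν * ∑ m, ∑' w, f m * G m w := by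
      rw [Finset.mul_sum]
      refine Finset.sum_congr rfl fun m _ => ?_
      rw [tsum_mul_left]
      ring
    _ = D * (-Complex.I * τ) ^ r * (-τ) ^ ν * ∑' w, ∑ m, f m * G m (-w) := by
      rw [← Summable.tsum_finsetSum fun m _ => (hGs m).mul_left (f m)]
      rw [hflip]
    _ = D * (-Complex.I * τ) ^ r * (-τ) ^ ν *
        ((-1) ^ ν * theta ℓ p (finiteFourier 𝒬 f) τ) := by
      rw [tsum_congr hneg, tsum_mul_left, theta]
    _ = _ := inversion_factor_eq _ _ _ _ _

/-- `S` acts on theta series by the finite Fourier transform, up to a constant that is the same for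
all spherical polynomials. -/
theorem theta_slash_S [FiniteDimensional ℚ V] (h𝒬 : IsQuadraticModule 𝒬)
    (ℓ : Lift 𝒬 L Q) {r : ℕ} (hV : Module.finrank ℚ V = 2 * r) :
    ∃ c : ℂ, c ≠ 0 ∧ ∀ (ν : ℕ) (p : V → ℂ), IsSpherical Q ν p → ∀ f : M → ℂ,
      theta ℓ p f ∣[(r + ν : ℤ)] ModularGroup.S = c • theta ℓ p (finiteFourier 𝒬 f) := by
  obtain ⟨c, hc, h⟩ := exists_theta_inversion h𝒬 ℓ hV
  refine ⟨c, hc, fun ν p hp f => ?_⟩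
  ext τ
  rw [ModularForm.SL_slash_apply, h ν p hp f τ (ModularGroup.S • τ), ModularGroup.denom_S]
  · rw [zpow_neg, Pi.smul_apply, smul_eq_mul]
    have : (τ : ℂ) ^ ((r : ℤ) + ν) = (τ : ℂ) ^ (r + ν) := by
      rw [← zpow_natCast]
      push_cast
      rfl
    rw [this]
    have hτ : (τ : ℂ) ^ (r + ν) ≠ 0 := pow_ne_zero _ (UpperHalfPlane.ne_zero τ)
    field_simp
  · rw [UpperHalfPlane.modular_S_smul]
    change (-(τ : ℂ))⁻¹ = _
    rw [neg_div, one_div, inv_neg]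

end Theta

/-! ### The Weil representation -/

section WeilRepresentation

variable {V : Type*} [AddCommGroup V] [Module ℚ V] {M : Type*}
  [AddCommGroup M] {𝒬 : M → QModZ} {L : Submodule ℤ V} {Q : QuadraticForm ℚ V}

theorem phaseMul_apply {X : Type*} (q : X → QModZ) (f : X → ℂ) (x : X) :
    phaseMul q f x = e (q x) * f x := rfl

theorem phaseMul_conj_phase {X : Type*} (q : X → QModZ) :
    phaseMul q (fun x => e (-q x)) = fun _ => 1 := by
  ext x
  rw [phaseMul_apply, ← e_add, add_neg_cancel, e_zero]

/-- The action of `SL(2, ℤ)` on pairs of vectors of the dual lattice. -/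
def pairAct (A : SL(2, ℤ)) (v : Fin 2 → dualLattice L Q) : Fin 2 → dualLattice L Q :=
  fun i => A i 0 • v 0 + A i 1 • v 1

theorem pairAct_mul (A B : SL(2, ℤ)) (v : Fin 2 → dualLattice L Q) :
    pairAct (A * B) v = pairAct A (pairAct B v) := by
  ext1 i
  simp only [pairAct, Matrix.SpecialLinearGroup.coe_mul, Matrix.mul_apply, Fin.sum_univ_two]
  module

theorem pairAct_one (v : Fin 2 → dualLattice L Q) : pairAct 1 v = v := by
  ext1 i
  fin_cases i <;> simp [pairAct]

/-- The Heisenberg operator attached to `v`: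
`f ↦ (x ↦ e(B(v₁, v₀)/2) e(ℬ(x, v₀)) f(x + v₁))`. The factor `1/2` makes sense only on the dual
lattice, not on `M`; with it the operators are permuted by `SL(2, ℤ)` without multipliers. -/
def heis (ℓ : Lift 𝒬 L Q) (v : Fin 2 → dualLattice L Q) : Module.End ℂ (M → ℂ) where
  toFun f x := e ((QuadraticMap.polar Q (v 1 : V) (v 0 : V) / 2 : ℚ) : QModZ) *
    e (QuadraticMap.polar 𝒬 x (ℓ.proj (v 0))) * f (x + ℓ.proj (v 1))
  map_add' f g := by
    ext x
    simp [mul_add]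
  map_smul' c f := by
    ext x
    simp [mul_left_comm]

theorem heis_apply (ℓ : Lift 𝒬 L Q) (v : Fin 2 → dualLattice L Q) (f : M → ℂ) (x : M) :
    heis ℓ v f x = e ((QuadraticMap.polar Q (v 1 : V) (v 0 : V) / 2 : ℚ) : QModZ) *
      e (QuadraticMap.polar 𝒬 x (ℓ.proj (v 0))) * f (x + ℓ.proj (v 1)) := rfl

/-- Together with `heis_S`: conjugating the Heisenberg operators by the operators of the generators
amounts to acting on their parameters. -/
theorem heis_T (h𝒬 : IsQuadraticModule 𝒬) (ℓ : Lift 𝒬 L Q) (v : Fin 2 → dualLattice L Q)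
    (f : M → ℂ) :
    phaseMul 𝒬 (heis ℓ (pairAct ModularGroup.T v) f) = heis ℓ v (phaseMul 𝒬 f) := by
  have h0 : pairAct ModularGroup.T v 0 = v 0 + v 1 := by simp [pairAct, ModularGroup.T]
  have h1 : pairAct ModularGroup.T v 1 = v 1 := by simp [pairAct, ModularGroup.T]
  ext x
  rw [phaseMul_apply, heis_apply, heis_apply, phaseMul_apply, h0, h1, map_add, map_add_eq 𝒬 x,
    ℓ.map_proj, h𝒬.polar_add_right]
  have h2 : ((QuadraticMap.polar Q (v 1 : V) ((v 0 + v 1 : dualLattice L Q) : V) / 2 : ℚ) : QModZ)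
      = ((QuadraticMap.polar Q (v 1 : V) (v 0 : V) / 2 : ℚ) : QModZ)
        + ((Q (v 1 : V) : ℚ) : QModZ) := by
    rw [Submodule.coe_add, QuadraticMap.polar_add_right, polar_self_eq]
    rw [← AddCircle.coe_add]
    congr 1
    ring
  rw [h2]
  simp only [e_add]
  ring

section FiniteFourier

variable [Fintype M]

theorem heis_S (h𝒬 : IsQuadraticModule 𝒬) (ℓ : Lift 𝒬 L Q) (v : Fin 2 → dualLattice L Q)
    (f : M → ℂ) :
    finiteFourier 𝒬 (heis ℓ (pairAct ModularGroup.S v) f) = heis ℓ v (finiteFourier 𝒬 f) := by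
  have h0 : pairAct ModularGroup.S v 0 = -v 1 := by simp [pairAct, ModularGroup.S]
  have h1 : pairAct ModularGroup.S v 1 = v 0 := by simp [pairAct, ModularGroup.S]
  ext x
  rw [finiteFourier_apply, heis_apply, finiteFourier_apply,
    ← (Equiv.subRight (ℓ.proj (v 0))).sum_comp, Finset.mul_sum]
  refine Finset.sum_congr rfl fun y _ => ?_
  rw [heis_apply, h0, h1, Equiv.subRight_apply, sub_add_cancel, map_neg, h𝒬.polar_neg_right,
    sub_eq_add_neg, h𝒬.polar_add_right, h𝒬.polar_add_left, h𝒬.polar_add_left,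
    h𝒬.polar_neg_right, h𝒬.polar_neg_left, ← mul_assoc, ← mul_assoc, ← mul_assoc, ← e_add, ← e_add,
    ← e_add, ← e_add, ℓ.polar_proj, Submodule.coe_neg, QuadraticMap.polar_neg_right,
    QuadraticMap.polar_comm 𝒬 y, QuadraticMap.polar_comm Q (v 0 : V)]
  congr 2
  have h2 : ((-QuadraticMap.polar Q (v 1 : V) (v 0 : V) / 2 : ℚ) : QModZ)
      + ((QuadraticMap.polar Q (v 1 : V) (v 0 : V) : ℚ) : QModZ)
      = ((QuadraticMap.polar Q (v 1 : V) (v 0 : V) / 2 : ℚ) : QModZ) := by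
    rw [← AddCircle.coe_add]
    congr 1
    ring
  rw [← h2]
  abel

theorem finiteFourier_single_zero [DecidableEq M] (h𝒬 : IsQuadraticModule 𝒬) :
    finiteFourier 𝒬 (Pi.single 0 1) = fun _ => 1 := by
  ext x
  rw [finiteFourier_apply, Finset.sum_eq_single 0]
  · rw [QuadraticMap.polar_comm, h𝒬.polar_zero_left, neg_zero, e_zero, Pi.single_eq_same, mul_one]
  · intro y _ hy
    rw [Pi.single_eq_of_ne hy, mul_zero]
  · simp

theorem finiteFourier_phase (h𝒬 : IsQuadraticModule 𝒬) :
    finiteFourier 𝒬 (phaseMul 𝒬 fun _ => 1) = gaussSum 𝒬 • fun x => e (-𝒬 x) := by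
  ext x
  rw [finiteFourier_apply, Pi.smul_apply, smul_eq_mul, gaussSum,
    ← (Equiv.subRight x).sum_comp fun y => e (𝒬 y), Finset.sum_mul]
  refine Finset.sum_congr rfl fun y _ => ?_
  rw [phaseMul_apply, mul_one, ← e_add, ← e_add, Equiv.subRight_apply, sub_eq_add_neg, map_add_eq 𝒬,
    h𝒬.even, h𝒬.polar_neg_right, QuadraticMap.polar_comm 𝒬 x y]
  congr 1
  abel

theorem T_mul_S_mul_T_mul_S_mul_T : ModularGroup.T * ModularGroup.S * ModularGroup.T *
    ModularGroup.S * ModularGroup.T = ModularGroup.S := by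
  ext i j
  fin_cases i <;> fin_cases j <;> decide

theorem sum_e_polar [DecidableEq M] (h𝒬 : IsQuadraticModule 𝒬) (x : M) :
    ∑ y, e (QuadraticMap.polar 𝒬 x y) = if x = 0 then (Fintype.card M : ℂ) else 0 := by
  split_ifs with hx
  · simp [hx, h𝒬.polar_zero_left, e_zero]
  · let ψ : AddChar M ℂ :=
      { toFun := fun y => e (QuadraticMap.polar 𝒬 x y)
        map_zero_eq_one' := by
          rw [QuadraticMap.polar_comm, h𝒬.polar_zero_left, e_zero]
        map_add_eq_mul' := fun y z => by rw [h𝒬.polar_add_right, e_add] }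
    refine AddChar.sum_eq_zero_of_ne_one (ψ := ψ) fun h => ?_
    obtain ⟨y, hy⟩ := h𝒬.nondegenerate x hx
    exact hy (e_eq_one_iff.mp (DFunLike.congr_fun h y))

end FiniteFourier

variable [FiniteDimensional ℚ V]

/-- The theta series with constant polynomial, as a linear map. -/
def thetaOne [Finite M] (ℓ : Lift 𝒬 L Q) : (M → ℂ) →ₗ[ℂ] (ℍ → ℂ) :=
  (isLinearMap_theta ℓ (isSpherical_one Q)).mk' _

theorem thetaOne_apply [Finite M] (ℓ : Lift 𝒬 L Q) (f : M → ℂ) :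
    thetaOne ℓ f = theta ℓ (fun _ => 1) f := rfl

theorem thetaOne_slash_T [Finite M] (ℓ : Lift 𝒬 L Q) (f : M → ℂ) (k : ℤ) :
    thetaOne ℓ f ∣[k] ModularGroup.T = thetaOne ℓ (phaseMul 𝒬 f) :=
  theta_slash_T ℓ _ f k

variable [Fintype M]

/-- The constant in the inversion formula is the inverse of the Gauss sum: the relation
`TSTST = S` is applied to the theta series of `L`. -/
theorem mul_gaussSum_eq_one (h𝒬 : IsQuadraticModule 𝒬) (ℓ : Lift 𝒬 L Q) {k : ℤ} {c : ℂ}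
    (hc : c ≠ 0)
    (hS : ∀ f, thetaOne ℓ f ∣[k] ModularGroup.S = c • thetaOne ℓ (finiteFourier 𝒬 f)) :
    c * gaussSum 𝒬 = 1 := by
  classical
  have hT := fun f => thetaOne_slash_T ℓ f k
  have h1 : phaseMul 𝒬 (Pi.single 0 1) = (Pi.single 0 1 : M → ℂ) := by
    ext x
    rw [phaseMul_apply]
    by_cases hx : x = 0
    · rw [hx, h𝒬.map_zero, e_zero, one_mul]
    · rw [Pi.single_eq_of_ne hx, mul_zero]
  have hne : thetaOne ℓ (fun _ => 1) ≠ 0 := by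
    have := theta_one_ne_zero ℓ (f := fun _ => 1) (fun _ => zero_le_one) (a := 0) one_pos
    simpa [thetaOne_apply] using this
  have h2 : thetaOne ℓ (Pi.single 0 1) ∣[k] (ModularGroup.T * ModularGroup.S * ModularGroup.T *
      ModularGroup.S * ModularGroup.T) = (c * (c * gaussSum 𝒬)) • thetaOne ℓ (fun _ => 1) := by
    simp only [SlashAction.slash_mul]
    rw [hT, h1, hS, finiteFourier_single_zero h𝒬, ModularForm.SL_smul_slash, hT,
      ModularForm.SL_smul_slash, hS, finiteFourier_phase h𝒬, map_smul, ModularForm.SL_smul_slash,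
      ModularForm.SL_smul_slash, ModularForm.SL_smul_slash, hT, phaseMul_conj_phase, smul_smul,
      smul_smul, mul_assoc]
  rw [T_mul_S_mul_T_mul_S_mul_T, hS, finiteFourier_single_zero h𝒬] at h2
  have h3 := smul_left_injective ℂ hne h2
  have h4 : c * (c * gaussSum 𝒬) = c * 1 := by rw [mul_one]; exact h3.symm
  exact mul_left_cancel₀ hc h4

/-- `W` describes the slash action of `A` on all Heisenberg translates of theta series. -/
def Intertwines (ℓ : Lift 𝒬 L Q) (k : ℤ) (A : SL(2, ℤ)) (W : Module.End ℂ (M → ℂ)) : Prop :=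
  ∀ f v, thetaOne ℓ (heis ℓ (pairAct A v) f) ∣[k] A = thetaOne ℓ (heis ℓ v (W f))

/-- A function all of whose Heisenberg translates have vanishing theta series is zero: Fourier
inversion on `M` isolates the theta series of a single coset, which is a positive sum. -/
theorem eq_zero_of_thetaOne_heis (h𝒬 : IsQuadraticModule 𝒬) (ℓ : Lift 𝒬 L Q) {f : M → ℂ}
    (h : ∀ v, thetaOne ℓ (heis ℓ v f) = 0) : f = 0 := by
  classical
  ext a
  choose s hs using ℓ.proj_surjective
  -- only translates by `(α, 0)` are needed: they multiply `f` by all characters of `M`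
  have h1 : ∑ y, e (-QuadraticMap.polar 𝒬 a y) • heis ℓ ![s y, 0] f
      = ((Fintype.card M : ℂ) * f a) • Pi.single a 1 := by
    ext x
    have h2 : ∀ y, (e (-QuadraticMap.polar 𝒬 a y) • heis ℓ ![s y, 0] f) x
        = e (QuadraticMap.polar 𝒬 (x - a) y) * f x := by
      intro y
      rw [Pi.smul_apply, heis_apply, smul_eq_mul]
      simp only [Matrix.cons_val_zero, Matrix.cons_val_one, hs, map_zero, add_zero,
        Submodule.coe_zero, QuadraticMap.polar_zero_left, zero_div]
      rw [AddCircle.coe_zero, e_zero, one_mul, ← mul_assoc, ← e_add, sub_eq_add_neg,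
        h𝒬.polar_add_left, h𝒬.polar_neg_left, add_comm]
    rw [Finset.sum_apply, Finset.sum_congr rfl fun y _ => h2 y, ← Finset.sum_mul,
      sum_e_polar h𝒬]
    by_cases hx : x = a
    · simp [hx]
    · simp [hx, sub_eq_zero]
  have h3 := congrArg (thetaOne ℓ) h1
  simp only [map_sum, map_smul, h, smul_zero, Finset.sum_const_zero] at h3
  have h4 : thetaOne ℓ (Pi.single a 1) ≠ 0 := by
    have := theta_one_ne_zero ℓ (f := Pi.single a 1)
      (fun m => by by_cases hm : m = a <;> simp [hm]) (a := a) (by simp)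
    have h5 : (fun m => ((Pi.single a 1 : M → ℝ) m : ℂ)) = Pi.single a 1 := by
      ext m
      by_cases hm : m = a <;> simp [hm]
    rwa [h5] at this
  have h5 := (smul_eq_zero.mp h3.symm).resolve_right h4
  exact (mul_eq_zero.mp h5).resolve_left (by exact_mod_cast Fintype.card_ne_zero)

/-- By `eq_zero_of_thetaOne_heis`, the operator attached to a matrix is determined by it, which
makes `A ↦ W` multiplicative. -/
theorem Intertwines.unique (h𝒬 : IsQuadraticModule 𝒬) {ℓ : Lift 𝒬 L Q} {k : ℤ} {A : SL(2, ℤ)}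
    {W W' : Module.End ℂ (M → ℂ)} (h : Intertwines ℓ k A W) (h' : Intertwines ℓ k A W') :
    W = W' := by
  refine LinearMap.ext fun f => sub_eq_zero.mp (eq_zero_of_thetaOne_heis h𝒬 ℓ fun v => ?_)
  rw [map_sub, map_sub, ← h f v, ← h' f v, sub_self]

theorem Intertwines.one (ℓ : Lift 𝒬 L Q) (k : ℤ) : Intertwines ℓ k 1 1 := by
  intro f v
  rw [pairAct_one, SlashAction.slash_one]
  rfl

theorem Intertwines.mul {ℓ : Lift 𝒬 L Q} {k : ℤ} {A B : SL(2, ℤ)}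
    {W W' : Module.End ℂ (M → ℂ)} (h : Intertwines ℓ k A W) (h' : Intertwines ℓ k B W') :
    Intertwines ℓ k (A * B) (W' * W) := by
  intro f v
  rw [pairAct_mul, SlashAction.slash_mul, h, h']
  rfl

theorem Intertwines.exists_inv (h𝒬 : IsQuadraticModule 𝒬) {ℓ : Lift 𝒬 L Q} {k : ℤ} {A : SL(2, ℤ)}
    {W : Module.End ℂ (M → ℂ)} (h : Intertwines ℓ k A W) :
    ∃ W', Intertwines ℓ k A⁻¹ W' := by
  have hinv : ∀ v : Fin 2 → dualLattice L Q, pairAct A (pairAct A⁻¹ v) = v := fun v => by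
    rw [← pairAct_mul, mul_inv_cancel, pairAct_one]
  have hinj : Function.Injective W := by
    rw [injective_iff_map_eq_zero]
    intro f hf
    refine eq_zero_of_thetaOne_heis h𝒬 ℓ fun v => ?_
    have h1 := h f (pairAct A⁻¹ v)
    rw [hf, map_zero, map_zero, hinv] at h1
    exact (SlashAction.slash_eq_zero_iff k A _).mp h1
  let W' := LinearEquiv.ofInjectiveEndo W hinj
  refine ⟨W'.symm.toLinearMap, fun f v => ?_⟩
  have h1 := h (W'.symm f) v
  have h2 : W (W'.symm f) = f := W'.apply_symm_apply f
  have h3 := h (W'.symm f) (pairAct A⁻¹ v)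
  rw [hinv, h2] at h3
  rw [← h3, ← SlashAction.slash_mul, mul_inv_cancel, SlashAction.slash_one]
  rfl

theorem intertwines_T (h𝒬 : IsQuadraticModule 𝒬) (ℓ : Lift 𝒬 L Q) (k : ℤ) :
    Intertwines ℓ k ModularGroup.T (phaseMul 𝒬) := by
  intro f v
  rw [thetaOne_slash_T, heis_T h𝒬]

theorem intertwines_S (h𝒬 : IsQuadraticModule 𝒬) (ℓ : Lift 𝒬 L Q) {k : ℤ} {c : ℂ}
    (hS : ∀ f, thetaOne ℓ f ∣[k] ModularGroup.S = c • thetaOne ℓ (finiteFourier 𝒬 f)) :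
    Intertwines ℓ k ModularGroup.S (c • finiteFourier 𝒬) := by
  intro f v
  rw [hS, heis_S h𝒬, LinearMap.smul_apply, map_smul, map_smul]

theorem SL2Z_induction {p : SL(2, ℤ) → Prop} (hS : p ModularGroup.S) (hT : p ModularGroup.T)
    (one : p 1) (mul : ∀ A B, p A → p B → p (A * B)) (inv : ∀ A, p A → p A⁻¹) (A : SL(2, ℤ)) :
    p A := by
  have hA : A ∈ Subgroup.closure {ModularGroup.S, ModularGroup.T} := by
    rw [SpecialLinearGroup.SL2Z_generators]
    trivial
  induction hA using Subgroup.closure_induction with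
  | mem x hx =>
    rcases hx with rfl | hx
    · exact hS
    · rw [Set.mem_singleton_iff.mp hx]
      exact hT
  | one => exact one
  | mul x y _ _ hx hy => exact mul x y hx hy
  | inv x _ hx => exact inv x hx

theorem exists_isWeilRepresentation (h𝒬 : IsQuadraticModule 𝒬) (ℓ : Lift 𝒬 L Q) {k : ℤ} {c : ℂ}
    (hc : c ≠ 0)
    (hS : ∀ f, thetaOne ℓ f ∣[k] ModularGroup.S = c • thetaOne ℓ (finiteFourier 𝒬 f)) :
    ∃ ω : SL(2, ℤ)ᵐᵒᵖ →* Module.End ℂ (M → ℂ), IsWeilRepresentation 𝒬 ω := by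
  have hcγ : c = (gaussSum 𝒬)⁻¹ := eq_inv_of_mul_eq_one_left (mul_gaussSum_eq_one h𝒬 ℓ hc hS)
  have hex : ∀ A, ∃ W, Intertwines ℓ k A W := by
    intro A
    induction A using SL2Z_induction with
    | hS => exact ⟨_, intertwines_S h𝒬 ℓ hS⟩
    | hT => exact ⟨_, intertwines_T h𝒬 ℓ k⟩
    | one => exact ⟨_, Intertwines.one ℓ k⟩
    | mul A B hA hB =>
      obtain ⟨W, hW⟩ := hA
      obtain ⟨W', hW'⟩ := hB
      exact ⟨_, hW.mul hW'⟩
    | inv A hA =>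
      obtain ⟨W, hW⟩ := hA
      exact hW.exists_inv h𝒬
  choose W hW using hex
  let ω : SL(2, ℤ)ᵐᵒᵖ →* Module.End ℂ (M → ℂ) :=
    { toFun := fun A => W A.unop
      map_one' := (hW _).unique h𝒬 (Intertwines.one ℓ k)
      map_mul' := fun A B => (hW _).unique h𝒬 ((hW B.unop).mul (hW A.unop)) }
  refine ⟨ω, fun f x => ?_, fun f x => ?_⟩
  · change W ModularGroup.T f x = _
    rw [(hW _).unique h𝒬 (intertwines_T h𝒬 ℓ k), phaseMul_apply]
  · change W ModularGroup.S f x = _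
    rw [(hW _).unique h𝒬 (intertwines_S h𝒬 ℓ hS), hcγ]
    rfl

theorem IsWeilRepresentation.unique {ω ω' : SL(2, ℤ)ᵐᵒᵖ →* Module.End ℂ (M → ℂ)}
    (h : IsWeilRepresentation 𝒬 ω) (h' : IsWeilRepresentation 𝒬 ω') : ω = ω' := by
  refine MonoidHom.ext fun A => ?_
  have key : ∀ B : SL(2, ℤ), ω (MulOpposite.op B) = ω' (MulOpposite.op B) := by
    intro B
    induction B using SL2Z_induction with
    | hS =>
      ext1 f
      ext x
      rw [h.apply_S, h'.apply_S]
    | hT =>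
      ext1 f
      ext x
      rw [h.apply_T, h'.apply_T]
    | one => rw [MulOpposite.op_one, map_one, map_one]
    | mul A B hA hB => rw [MulOpposite.op_mul, map_mul, map_mul, hA, hB]
    | inv A hA =>
      have h1 : ω (MulOpposite.op A⁻¹) * ω (MulOpposite.op A) = 1 := by
        rw [← map_mul, ← MulOpposite.op_mul, mul_inv_cancel, MulOpposite.op_one, map_one]
      have h2 : ω' (MulOpposite.op A) * ω' (MulOpposite.op A⁻¹) = 1 := by
        rw [← map_mul, ← MulOpposite.op_mul, inv_mul_cancel, MulOpposite.op_one, map_one]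
      rw [← hA] at h2
      exact left_inv_eq_right_inv h1 h2
  exact key A.unop

end WeilRepresentation

end WeilTheta

end

theorem mainTheorem3
    {M : Type*} [AddCommGroup M] [Fintype M]
    (𝒬 : M → WeilTheta.QModZ) (h𝒬 : WeilTheta.IsQuadraticModule 𝒬)
    {V : Type*} [AddCommGroup V] [Module ℚ V] [FiniteDimensional ℚ V]
    (r : ℕ) (hV : Module.finrank ℚ V = 2 * r)
    (L : Submodule ℤ V) (Q : QuadraticForm ℚ V) (ℓ : WeilTheta.Lift 𝒬 L Q)
    (ν : ℕ) (p : V → ℂ) (hp : WeilTheta.IsSpherical Q ν p) :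
    (∃! ω : SL(2, ℤ)ᵐᵒᵖ →* Module.End ℂ (M → ℂ), WeilTheta.IsWeilRepresentation 𝒬 ω) ∧
    (∀ (f : M → ℂ) (τ : ℍ), Summable (WeilTheta.thetaTerm ℓ p f τ)) ∧
    IsLinearMap ℂ (WeilTheta.theta ℓ p) ∧
    ∀ ω : SL(2, ℤ)ᵐᵒᵖ →* Module.End ℂ (M → ℂ), WeilTheta.IsWeilRepresentation 𝒬 ω →
      ∀ (f : M → ℂ) (A : SL(2, ℤ)),
        WeilTheta.theta ℓ p f ∣[(r + ν : ℤ)] A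
          = WeilTheta.theta ℓ p (ω (MulOpposite.op A) f) := by
  obtain ⟨c, hc, hS⟩ := WeilTheta.theta_slash_S h𝒬 ℓ hV
  have hS₁ : ∀ f, WeilTheta.thetaOne ℓ f ∣[((r : ℤ) + (0 : ℕ))] ModularGroup.S
      = c • WeilTheta.thetaOne ℓ (WeilTheta.finiteFourier 𝒬 f) :=
    hS 0 _ (WeilTheta.isSpherical_one Q)
  have hlin := WeilTheta.isLinearMap_theta ℓ hp
  have hcγ : c = (WeilTheta.gaussSum 𝒬)⁻¹ :=
    eq_inv_of_mul_eq_one_left (WeilTheta.mul_gaussSum_eq_one h𝒬 ℓ hc hS₁)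
  refine ⟨?_, WeilTheta.summable_thetaTerm ℓ hp, hlin, fun ω hω f A => ?_⟩
  · obtain ⟨ω, hω⟩ := WeilTheta.exists_isWeilRepresentation h𝒬 ℓ hc hS₁
    exact ⟨ω, hω, fun ω' hω' => hω'.unique hω⟩
  · induction A using WeilTheta.SL2Z_induction generalizing f with
    | hS =>
      rw [hS ν p hp, ← hlin.map_smul]
      congr 1
      ext x
      rw [hω.apply_S, hcγ]
      rfl
    | hT =>
      rw [WeilTheta.theta_slash_T]
      congr 1
      ext x
      rw [hω.apply_T]
      rfl
    | one => rw [SlashAction.slash_one, MulOpposite.op_one, map_one, Module.End.one_apply]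
    | mul A B hA hB =>
      rw [SlashAction.slash_mul, hA, hB, MulOpposite.op_mul, map_mul, Module.End.mul_apply]
    | inv A hA =>
      have h1 : ω (MulOpposite.op A) (ω (MulOpposite.op A⁻¹) f) = f := by
        rw [← Module.End.mul_apply, ← map_mul, ← MulOpposite.op_mul, inv_mul_cancel,
          MulOpposite.op_one, map_one, Module.End.one_apply]
      conv_lhs => rw [← h1]
      rw [← hA, ← SlashAction.slash_mul, mul_inv_cancel, SlashAction.slash_one]
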